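/- Let $X=(X_n)_{n\ge 0}$ be an irreducible (not necessarily aperiodic) time-homogeneous Markov chain on a nonempty finite or countably infinite state space $S$ with transition matrix $P$, and write $P_x,E_x$ for probability and expectation given $X_0=x$. For $v:S\to\mathbb R_+$ write $(Pv)(x)=\sum_{y\in S}P(x,y)v(y)\in[0,\infty]$. For $z\in S$ let $\tau(z)=\inf\{n\ge 1: X_n=z\}$. Let $f:S\to\mathbb R$, and put $S_n(f)=\sum_{i=0}^{n-1}f(X_i)$. Let $K\subseteq S$ be finite, and suppose that there are $v_1,v_2:S\to\mathbb R_+$ such that $(Pv_i)(x)<\infty$ for $x\in K$, $i=1,2$, and $$(Pv_1)(x)\le v_1(x)-(|f(x)|+1),\qquad (Pv_2)(x)\le v_2(x)-(|f(x)|+1)\,v_1(x)\qquad\text{for all } x\in S\setminus K.$$ Then: 1. $X$ is positive recurrent, i.e. $E_z\tau(z)<\infty$ for every $z\in S$, and it has a unique stationary distribution $\pi$. 2. $f\in L^1(\pi)$, i.e. $\sum_{x}\pi(x)|f(x)|<\infty$. Write $\pi f=\sum_x\pi(x)f(x)$ and $f_c=f-\pi f$. 3. For every $z\in S$, $E_z\bigl(\sum_{j=0}^{\tau(z)-1}|f_c(X_j)|\bigr)^2<\infty$.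 4. For all $x,z\in S$, $\tau(z)<\infty$ $P_x$-almost surely and $g_z(x)=E_x\sum_{j=0}^{\tau(z)-1}f_c(X_j)$ is well defined and finite (the sum is $P_x$-integrable); moreover $g_zf_c\in L^1(\pi)$ for every $z\in S$, and $f_c^2\in L^1(\pi)$. 5. There is $\sigma\ge 0$ such that, for every $z\in S$, $$\sigma^2=\frac{E_z\bigl(\sum_{j=0}^{\tau(z)-1}f_c(X_j)\bigr)^2}{E_z\tau(z)}=2E_\pi[g_z(X_0)f_c(X_0)]-E_\pi[f_c(X_0)^2],$$ where $E_\pi$ is expectation when $X_0$ has distribution $\pi$, and, for every initial distribution of $X_0$, $$\frac{S_n(f)-n\,\pi f}{\sqrt n}\Rightarrow\sigma N(0,1)\qquad (n\to\infty),$$ where $\Rightarrow$ denotes weak convergence and $N(0,1)$ is a standard normal random variable. -/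

import Mathlib

open MeasureTheory ProbabilityTheory Filter
open scoped ENNReal NNReal

noncomputable section

namespace MarkovCLT

variable {S : Type*} [MeasurableSpace S]

/-- The law `P_ν` on the path space `ℕ → S` of the time-homogeneous Markov chain with initial
distribution `ν` and one-step transition kernel `P` (Ionescu-Tulcea). The chain is the coordinate
process `X_n ω = ω n`. -/
def chainLaw (P : Kernel S S) [IsMarkovKernel P] (ν : Measure S) : Measure (ℕ → S) :=
  Kernel.trajMeasure (X := fun _ => S) ν
    (fun n => P.comap (fun h => h ⟨n, Finset.mem_Iic.2 le_rfl⟩) (measurable_pi_apply _))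

instance (P : Kernel S S) [IsMarkovKernel P] (ν : Measure S) [IsProbabilityMeasure ν] :
    IsProbabilityMeasure (chainLaw P ν) := by
  unfold chainLaw; infer_instance

/-- The law `P_x` of the chain started at `x`. -/
abbrev lawFrom (P : Kernel S S) [IsMarkovKernel P] (x : S) : Measure (ℕ → S) :=
  chainLaw P (Measure.dirac x)

/-- `τ(z) = inf {n ≥ 1 : X_n = z}`, with value `⊤` if there is no such `n`. -/
def returnTime (z : S) (ω : ℕ → S) : ℕ∞ :=
  ⨅ (n : ℕ) (_ : 1 ≤ n ∧ ω n = z), (n : ℕ∞)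

/-- `E_x τ(z)`, as an extended nonnegative number. -/
def meanReturnTime (P : Kernel S S) [IsMarkovKernel P] (x z : S) : ℝ≥0∞ :=
  ∫⁻ ω, (returnTime z ω : ℝ≥0∞) ∂(lawFrom P x)

/-- Positive recurrence: every state has finite mean return time. -/
def PositiveRecurrent (P : Kernel S S) [IsMarkovKernel P] : Prop :=
  ∀ z, meanReturnTime P z z < ∞

/-- `∑_{j < τ(z)} |h(X_j)|`, as an extended nonnegative number (an infinite series if
`τ(z) = ⊤`). -/
def absCycleSum (h : S → ℝ) (z : S) (ω : ℕ → S) : ℝ≥0∞ :=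
  ∑' j : ℕ, if (j : ℕ∞) < returnTime z ω then ‖h (ω j)‖ₑ else 0

/-- `∑_{j < τ(z)} h(X_j)`, meaningful on the event `τ(z) < ⊤`. -/
def cycleSum (h : S → ℝ) (z : S) (ω : ℕ → S) : ℝ :=
  ∑ j ∈ Finset.range (returnTime z ω).toNat, h (ω j)

/-- The centered function `f_c = f - π f`. -/
def centered (f : S → ℝ) (π : Measure S) (x : S) : ℝ := f x - ∫ y, f y ∂π

/-- `g_z(x) = E_x ∑_{j < τ(z)} f_c(X_j)`. -/
def poissonSol (P : Kernel S S) [IsMarkovKernel P] (f : S → ℝ) (π : Measure S) (z x : S) : ℝ :=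
  ∫ ω, cycleSum (centered f π) z ω ∂(lawFrom P x)

/-- `π` is a stationary distribution: a probability measure with `π P = π`. -/
def IsStationaryDistribution (P : Kernel S S) (π : Measure S) : Prop :=
  IsProbabilityMeasure π ∧ Kernel.Invariant P π

/-- `S_n(f) = ∑_{i < n} f(X_i)`. -/
def additiveFunctional (f : S → ℝ) (n : ℕ) (ω : ℕ → S) : ℝ :=
  ∑ i ∈ Finset.range n, f (ω i)

end MarkovCLT

end

set_option linter.unusedSectionVars false

/-! The proof is regenerative. Fix a state `z` and cut the path at its returns to `z`. The
occupation measure of one cycle records the expected costs up to the return, and the drift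
conditions enter only by bounding two such costs, with `H = |f| + 1`: the sum of `H` over a cycle,
and the sum of `H U`, where `U(y)` is the expected `H`-cost from `y` until the return to `z`. A
drift inequality bounds a cost by a telescoping sum along the path killed at `z`. For this the
exceptional set `K` has to be replaced by the single state `z`; irreducibility supplies a bounded
correction with as much drift on `K` as needed (`exists_drift_singleton`,
`occupation_moments_lt_top`).

Finite mean cycle length gives positive recurrence, and the normalized occupation measure is the
only stationary distribution (`eq_occupation_of_stationary`). So integrals over a cycle are
multiples of integrals against `π`; in particular the cycle sums of `f_c` are centered. Their square
is at most twice the sum over ordered pairs of times, whence the finite second moment. The exact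
form of this expansion, with the Markov property applied at the earlier time, gives the formula with
`g_z` (`integral_cycleSum_sq`).

By the strong Markov property the cycles are independent, and all but the first are identically
distributed. The CLT then concerns a sum over a random number `N` of cycles
(`tendstoInDistribution_of_renewal`). Replacing `N` by a deterministic number of order `n / E_z
τ(z)` costs a sum of predictable multiples of centered variables; its second moment is proportional
to `E|N - m|`, which is `o(n)` by the renewal theorem. The incomplete cycle and the first cycle are
negligible after division by `√n`. That `σ²` does not depend on `z` follows from uniqueness of the
limit law. -/

noncomputable section

namespace MarkovCLT

/-! ### Path space: atoms and the Markov property at a fixed time -/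

section

variable {S : Type*} [MeasurableSpace S]

open scoped Topology

/-- The shifted path `k ↦ ω (n + k)`. -/
def shift (n : ℕ) (ω : ℕ → S) : ℕ → S := fun k => ω (n + k)

@[fun_prop]
lemma measurable_shift (n : ℕ) : Measurable (shift (S := S) n) :=
  measurable_pi_lambda _ fun _ => measurable_pi_apply _

/-- Paths which agree with `s` up to time `n`. -/
def atom (n : ℕ) (s : ℕ → S) : Set (ℕ → S) := {ω | ∀ i ≤ n, ω i = s i}

variable [Countable S] [DiscreteMeasurableSpace S]

lemma measurableSet_atom (n : ℕ) (s : ℕ → S) : MeasurableSet (atom n s) := by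
  have : atom n s = ⋂ i ∈ Set.Iic n, (fun ω : ℕ → S => ω i) ⁻¹' {s i} := by
    ext ω; simp [atom]
  rw [this]
  exact MeasurableSet.biInter (Set.to_countable _) fun i _ =>
    measurable_pi_apply i (measurableSet_singleton _)

lemma frestrictLe_preimage_singleton (n : ℕ) (s : ℕ → S) :
    Preorder.frestrictLe (π := fun _ => S) n ⁻¹' {Preorder.frestrictLe n s} = atom n s := by
  ext ω
  simp only [Set.mem_preimage, Set.mem_singleton_iff, funext_iff, Preorder.frestrictLe_apply,
    Subtype.forall, Finset.mem_Iic, atom, Set.mem_ofPred_eq]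

/-- Finite measures on the path space are determined by their values on atoms. -/
lemma measure_ext_atom {μ₁ μ₂ : Measure (ℕ → S)} [IsFiniteMeasure μ₁] [IsFiniteMeasure μ₂]
    (h : ∀ n s, μ₁ (atom n s) = μ₂ (atom n s)) : μ₁ = μ₂ := by
  have hmap : ∀ n, μ₁.map (Preorder.frestrictLe (π := fun _ => S) n)
      = μ₂.map (Preorder.frestrictLe n) := by
    intro n
    refine Measure.ext_of_singleton fun a => ?_
    by_cases hS : IsEmpty S
    · exact (hS.false (a ⟨0, by simp⟩)).elim
    rw [not_isEmpty_iff] at hS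
    obtain ⟨s, rfl⟩ : ∃ s : ℕ → S, Preorder.frestrictLe n s = a :=
      ⟨fun i => if hi : i ≤ n then a ⟨i, by simpa using hi⟩ else hS.some, by
        ext ⟨i, hi⟩
        simp [Finset.mem_Iic.1 hi]⟩
    rw [Measure.map_apply (by fun_prop) (measurableSet_singleton _),
      Measure.map_apply (by fun_prop) (measurableSet_singleton _),
      frestrictLe_preimage_singleton, h]
  -- Every finite set of coordinates lies in an initial segment, so the laws of the prefixes
  -- determine all finite-dimensional laws.
  refine IsProjectiveLimit.unique (P := fun I : Finset ℕ => μ₁.map I.restrict)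
    (fun I => rfl) fun I => ?_
  have hI : I ⊆ Finset.Iic (I.sup id) := fun i hi =>
    Finset.mem_Iic.2 (Finset.le_sup (f := id) hi)
  have hr : (I.restrict : (ℕ → S) → _) =
      Finset.restrict₂ hI ∘ Preorder.frestrictLe (I.sup id) := rfl
  change _ = μ₁.map I.restrict
  rw [hr, ← Measure.map_map (by fun_prop) (by fun_prop),
    ← Measure.map_map (by fun_prop) (by fun_prop), hmap]

variable (P : Kernel S S) [IsMarkovKernel P]

lemma map_zero_chainLaw (ν : Measure S) [IsProbabilityMeasure ν] :
    (chainLaw P ν).map (fun ω => ω 0) = ν := by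
  have h1 : (fun ω : ℕ → S => ω 0) =
      (fun h : (i : Finset.Iic 0) → S => h ⟨0, by simp⟩) ∘ Preorder.frestrictLe 0 := rfl
  rw [h1, ← Measure.map_map (by fun_prop) (by fun_prop), chainLaw, Kernel.trajMeasure,
    Measure.map_comp _ _ (by fun_prop), Kernel.traj_map_frestrictLe, Kernel.partialTraj_self,
    Measure.id_comp, Measure.map_map (by fun_prop) (by fun_prop)]
  exact Measure.map_id

/-- Each step of the Ionescu-Tulcea construction appends a coordinate drawn from `P` at the last
state. From here on the proof uses the construction only through this formula and the law of the
initial coordinate. -/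
lemma chainLaw_atom (ν : Measure S) [IsProbabilityMeasure ν] (n : ℕ) (s : ℕ → S) :
    chainLaw P ν (atom n s) = ν {s 0} * ∏ i ∈ Finset.range n, P (s i) {s (i + 1)} := by
  induction n with
  | zero =>
    rw [Finset.range_zero, Finset.prod_empty, mul_one]
    conv_rhs => rw [← map_zero_chainLaw P ν]
    rw [Measure.map_apply (measurable_pi_apply 0) (measurableSet_singleton _)]
    congr 1
    ext ω; simp [atom]
  | succ n ih =>
    have hset : atom (n + 1) s = (fun ω : ℕ → S => (Preorder.frestrictLe n ω, ω (n + 1))) ⁻¹'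
        ({Preorder.frestrictLe n s} ×ˢ {s (n + 1)}) := by
      rw [Set.mk_preimage_prod, frestrictLe_preimage_singleton]
      ext ω
      simp only [atom, Set.mem_ofPred_eq, Set.mem_inter_iff, Set.mem_preimage,
        Set.mem_singleton_iff]
      constructor
      · exact fun h => ⟨fun i hi => h i (by omega), h _ le_rfl⟩
      · rintro ⟨h, h'⟩ i hi
        rcases Nat.lt_or_ge n i with h1 | h1
        · obtain rfl : i = n + 1 := by omega
          exact h'
        · exact h i h1
    have key := Kernel.map_frestrictLe_trajMeasure_compProd_eq_map_trajMeasure (X := fun _ => S)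
      (μ₀ := ν) (κ := fun n => P.comap (fun h => h ⟨n, Finset.mem_Iic.2 le_rfl⟩)
        (measurable_pi_apply _)) (a := n)
    have h2 := congrArg (fun m => m ({Preorder.frestrictLe n s} ×ˢ {s (n + 1)})) key
    beta_reduce at h2
    rw [Measure.map_apply (by fun_prop)
      ((measurableSet_singleton _).prod (measurableSet_singleton _)), ← hset,
      Measure.compProd_apply_prod (measurableSet_singleton _) (measurableSet_singleton _),
      Measure.restrict_singleton, lintegral_smul_measure, lintegral_dirac,
      Measure.map_apply (by fun_prop) (measurableSet_singleton _),
      frestrictLe_preimage_singleton] at h2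
    have h3 : chainLaw P ν (atom (n + 1) s)
        = chainLaw P ν (atom n s) * P (s n) {s (n + 1)} := h2.symm
    rw [h3, ih, Finset.prod_range_succ, mul_assoc]

/-- Markov property on an atom. -/
lemma markov_atom (ν : Measure S) [IsProbabilityMeasure ν] (n : ℕ) (s : ℕ → S)
    {B : Set (ℕ → S)} (hB : MeasurableSet B) :
    chainLaw P ν (atom n s ∩ shift n ⁻¹' B) = chainLaw P ν (atom n s) * lawFrom P (s n) B := by
  have : ((chainLaw P ν).restrict (atom n s)).map (shift n)
      = chainLaw P ν (atom n s) • lawFrom P (s n) := by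
    have : IsFiniteMeasure (chainLaw P ν (atom n s) • lawFrom P (s n)) :=
      Measure.smul_finite _ (measure_ne_top _ _)
    refine measure_ext_atom fun m t => ?_
    rw [Measure.map_apply (by fun_prop) (measurableSet_atom _ _),
      Measure.restrict_apply ((measurable_shift n) (measurableSet_atom _ _)),
      Measure.smul_apply, smul_eq_mul, chainLaw_atom P (Measure.dirac (s n))]
    -- The prefix `s` and the continuation `t` share the coordinate `n`: if they agree there they
    -- glue to one longer atom, otherwise both sides vanish.
    by_cases hst : s n = t 0
    · have : shift n ⁻¹' atom m t ∩ atom n s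
          = atom (n + m) (fun i => if i ≤ n then s i else t (i - n)) := by
        ext ω
        simp only [atom, shift, Set.mem_inter_iff, Set.mem_preimage, Set.mem_ofPred_eq]
        constructor
        · rintro ⟨h1, h2⟩ i hi
          split_ifs with h
          · exact h2 i h
          · have := h1 (i - n) (by omega)
            rwa [Nat.add_sub_cancel' (by omega)] at this
        · intro h
          refine ⟨fun k hk => ?_, fun i hi => ?_⟩
          · have h1 := h (n + k) (by omega)
            rcases Nat.eq_zero_or_pos k with rfl | hk0
            · simpa [hst] using h1
            · rwa [if_neg (by omega), Nat.add_sub_cancel_left] at h1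
          · have h1 := h i (by omega)
            rwa [if_pos hi] at h1
      rw [this, chainLaw_atom, chainLaw_atom, Finset.prod_range_add, Measure.dirac_apply' _
        (measurableSet_singleton _)]
      simp only [Nat.zero_le, if_true, hst, Set.indicator_of_mem (Set.mem_singleton _), Pi.one_apply,
        one_mul, mul_assoc]
      congr 2
      · refine Finset.prod_congr rfl fun i hi => ?_
        rw [Finset.mem_range] at hi
        rw [if_pos hi.le, if_pos (by omega)]
      · refine Finset.prod_congr rfl fun i hi => ?_
        rw [if_neg (show ¬ n + i + 1 ≤ n by omega)]
        have : n + i + 1 - n = i + 1 := by omega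
        rw [this]
        rcases Nat.eq_zero_or_pos i with rfl | hi0
        · simp [hst]
        · rw [if_neg (by omega), Nat.add_sub_cancel_left]
    · have : shift n ⁻¹' atom m t ∩ atom n s = ∅ := by
        ext ω
        simp only [atom, shift, Set.mem_inter_iff, Set.mem_preimage, Set.mem_ofPred_eq,
          Set.mem_empty_iff_false, iff_false, not_and]
        intro h1 h2
        exact hst ((h2 n le_rfl).symm.trans (h1 0 (Nat.zero_le _)))
      rw [this, measure_empty, Measure.dirac_apply' _ (measurableSet_singleton _),
        Set.indicator_of_notMem (by simpa using hst)]
      simp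
  have h := congrArg (fun m => m B) this
  rwa [Measure.map_apply (by fun_prop) hB, Measure.restrict_apply ((measurable_shift n) hB),
    Measure.smul_apply, smul_eq_mul, Set.inter_comm] at h

/-- Events that depend only on the first `n + 1` coordinates. -/
def DeterminedAt (n : ℕ) (G : Set (ℕ → S)) : Prop :=
  ∀ ω ω' : ℕ → S, (∀ i ≤ n, ω i = ω' i) → ω ∈ G → ω' ∈ G

omit [Countable S] [DiscreteMeasurableSpace S] in
lemma DeterminedAt.eq_preimage {n : ℕ} {G : Set (ℕ → S)} (hG : DeterminedAt n G) :
    G = Preorder.frestrictLe n ⁻¹' (Preorder.frestrictLe (π := fun _ => S) n '' G) := by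
  refine (Set.subset_preimage_image _ _).antisymm ?_
  rintro ω ⟨ω', hω', h⟩
  exact hG ω' ω (fun i hi => congrFun h ⟨i, Finset.mem_Iic.2 hi⟩) hω'

/-- There are only countably many prefixes of a given length, so every set of prefixes is
measurable. -/
lemma DeterminedAt.measurableSet {n : ℕ} {G : Set (ℕ → S)} (hG : DeterminedAt n G) :
    MeasurableSet G := by
  rw [hG.eq_preimage]
  exact (Preorder.measurable_frestrictLe n) (Set.to_countable _).measurableSet

/-- Markov property at a deterministic time `n`, on an event of the past and for a given
present state. -/
lemma markov_property (ν : Measure S) [IsProbabilityMeasure ν] {n : ℕ} {G : Set (ℕ → S)}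
    (hG : DeterminedAt n G) {y : S} (hy : ∀ ω ∈ G, ω n = y) {B : Set (ℕ → S)}
    (hB : MeasurableSet B) :
    chainLaw P ν (G ∩ shift n ⁻¹' B) = chainLaw P ν G * lawFrom P y B := by
  set I := Preorder.frestrictLe (π := fun _ => S) n '' G with hI
  -- An event of the past is a countable disjoint union of atoms, which reduces the claim to
  -- `markov_atom`.
  have hdec : ∀ C : Set (ℕ → S), MeasurableSet C → chainLaw P ν (G ∩ C) =
      ∑' a : I, chainLaw P ν (Preorder.frestrictLe (π := fun _ => S) n ⁻¹'
        {(a : ↥(Finset.Iic n) → S)} ∩ C) := by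
    intro C hC
    have : G ∩ C = ⋃ a : I, (Preorder.frestrictLe (π := fun _ => S) n ⁻¹'
        {(a : ↥(Finset.Iic n) → S)} ∩ C) := by
      rw [← Set.iUnion_inter]
      congr 1
      conv_lhs => rw [hG.eq_preimage, ← hI]
      ext ω; simp
    rw [this, measure_iUnion]
    · intro a b hab
      refine Set.disjoint_left.2 fun ω h1 h2 => hab (Subtype.ext ?_)
      exact h1.1.symm.trans h2.1
    · intro a
      exact ((Preorder.measurable_frestrictLe n) (measurableSet_singleton _)).inter hC
  have h1 := hdec Set.univ MeasurableSet.univ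
  simp only [Set.inter_univ] at h1
  rw [hdec _ ((measurable_shift n) hB), h1, ← ENNReal.tsum_mul_right]
  refine tsum_congr fun a => ?_
  obtain ⟨_, s, hs, rfl⟩ := a
  rw [frestrictLe_preimage_singleton, markov_atom P ν n s hB, hy s hs]

end

/-! ### Costs up to the return time and the drift bound -/

section

variable {S : Type*} [MeasurableSpace S]

/-- The event `{j < τ(z)}`. -/
def notReturned (z : S) (j : ℕ) : Set (ℕ → S) := {ω | (j : ℕ∞) < returnTime z ω}

omit [MeasurableSpace S] in
lemma lt_returnTime_iff {z : S} {j : ℕ} {ω : ℕ → S} :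
    (j : ℕ∞) < returnTime z ω ↔ ∀ i, 1 ≤ i → i ≤ j → ω i ≠ z := by
  constructor
  · intro h i h1 hij hz
    have : returnTime z ω ≤ i := iInf₂_le i ⟨h1, hz⟩
    have h2 := h.trans_le this
    norm_cast at h2
    omega
  · intro h
    have : ((j + 1 : ℕ) : ℕ∞) ≤ returnTime z ω := by
      refine le_iInf₂ fun n hn => ?_
      by_contra hlt
      norm_cast at hlt
      exact h n hn.1 (by omega) hn.2
    refine lt_of_lt_of_le ?_ this
    exact_mod_cast Nat.lt_succ_self j

omit [MeasurableSpace S] in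
lemma mem_notReturned {z : S} {j : ℕ} {ω : ℕ → S} :
    ω ∈ notReturned z j ↔ ∀ i, 1 ≤ i → i ≤ j → ω i ≠ z := lt_returnTime_iff

omit [MeasurableSpace S] in
lemma determinedAt_notReturned (z : S) (j : ℕ) : DeterminedAt j (notReturned z j) := by
  intro ω ω' h hω
  rw [mem_notReturned] at hω ⊢
  exact fun i h1 h2 => h i h2 ▸ hω i h1 h2

omit [MeasurableSpace S] in
lemma notReturned_zero (z : S) : notReturned z 0 = Set.univ := by
  ext ω; simp only [mem_notReturned, Set.mem_univ, iff_true]; intro i h1 h2; omega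

omit [MeasurableSpace S] in
lemma notReturned_succ (z : S) (j : ℕ) :
    notReturned z (j + 1) = notReturned z j ∩ {ω | ω (j + 1) ≠ z} := by
  ext ω
  simp only [mem_notReturned, Set.mem_inter_iff, Set.mem_ofPred_eq]
  constructor
  · exact fun h => ⟨fun i h1 h2 => h i h1 (by omega), h _ (by omega) le_rfl⟩
  · rintro ⟨h, h'⟩ i h1 h2
    rcases Nat.lt_or_ge j i with h3 | h3
    · obtain rfl : i = j + 1 := by omega
      exact h'
    · exact h i h1 h3

variable [Countable S] [DiscreteMeasurableSpace S]

lemma measurableSet_notReturned (z : S) (j : ℕ) : MeasurableSet (notReturned z j) :=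
  (determinedAt_notReturned z j).measurableSet

variable (P : Kernel S S) [IsMarkovKernel P]

lemma measurable_lawFrom : Measurable (lawFrom P) := .of_discrete

/-- Splitting `G` according to the value of `X_n` reduces this to `markov_property`, which needs the
present state to be fixed. -/
lemma markov_map_shift (ν : Measure S) [IsProbabilityMeasure ν] {n : ℕ} {G : Set (ℕ → S)}
    (hG : DeterminedAt n G) :
    ((chainLaw P ν).restrict G).map (shift n)
      = (((chainLaw P ν).restrict G).map (fun ω => ω n)).bind (lawFrom P) := by
  ext B hB
  have hGm := hG.measurableSet
  rw [Measure.map_apply (by fun_prop) hB, Measure.bind_apply hB (measurable_lawFrom P).aemeasurable,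
    lintegral_countable', Measure.restrict_apply (measurable_shift n hB)]
  have hdec : shift n ⁻¹' B ∩ G = ⋃ y : S, ((G ∩ {ω | ω n = y}) ∩ shift n ⁻¹' B) := by
    ext ω; simp [and_comm]
  have hm : ∀ y, MeasurableSet {ω : ℕ → S | ω n = y} := fun y =>
    (measurableSet_singleton y).preimage (measurable_pi_apply n)
  rw [hdec, measure_iUnion]
  · refine tsum_congr fun y => ?_
    rw [markov_property P ν (y := y) (n := n) _ (fun ω hω => hω.2) hB,
      Measure.map_apply (measurable_pi_apply n) (measurableSet_singleton y),
      Measure.restrict_apply (measurable_pi_apply n (measurableSet_singleton y)), mul_comm,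
      Set.inter_comm G]
    · rfl
    · intro ω ω' h hω
      exact ⟨hG ω ω' h hω.1, (h n le_rfl).symm.trans hω.2⟩
  · intro a b hab
    refine Set.disjoint_left.2 fun ω h1 h2 => hab ?_
    exact h1.1.2.symm.trans h2.1.2
  · intro y
    exact (hGm.inter (hm y)).inter (measurable_shift n hB)

lemma markov_lintegral (ν : Measure S) [IsProbabilityMeasure ν] {n : ℕ} {G : Set (ℕ → S)}
    (hG : DeterminedAt n G) {Φ : (ℕ → S) → ℝ≥0∞} (hΦ : Measurable Φ) :
    ∫⁻ ω in G, Φ (shift n ω) ∂(chainLaw P ν)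
      = ∫⁻ ω in G, (∫⁻ ω', Φ ω' ∂(lawFrom P (ω n))) ∂(chainLaw P ν) := by
  rw [← lintegral_map hΦ (measurable_shift n), markov_map_shift P ν hG,
    Measure.lintegral_bind (measurable_lawFrom P).aemeasurable hΦ.aemeasurable,
    lintegral_map .of_discrete (measurable_pi_apply n)]

lemma ae_zero_eq (x : S) : ∀ᵐ ω ∂(lawFrom P x), ω 0 = x := by
  have h : ∀ᵐ y ∂((lawFrom P x).map (fun ω => ω 0)), y = x := by
    rw [map_zero_chainLaw, ae_dirac_iff (.of_discrete (s := {y | y = x}))]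
  exact ae_of_ae_map (measurable_pi_apply 0).aemeasurable h

lemma map_one_lawFrom (x : S) : (lawFrom P x).map (fun ω => ω 1) = P x := by
  refine Measure.ext_of_singleton fun t => ?_
  rw [Measure.map_apply (measurable_pi_apply 1) (measurableSet_singleton t)]
  have h := chainLaw_atom P (Measure.dirac x) 1 (fun i => if i = 0 then x else t)
  simp only [if_true, Finset.range_one, Finset.prod_singleton, zero_add, one_ne_zero, if_false,
    Measure.dirac_apply_of_mem (Set.mem_singleton x), one_mul] at h
  rw [← h]
  refine measure_congr ?_
  filter_upwards [ae_zero_eq P x] with ω hω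
  refine propext ⟨fun (h1 : ω 1 = t) i hi => ?_, fun h1 => show ω 1 = t by simpa using h1 1 le_rfl⟩
  rcases Nat.eq_zero_or_pos i with rfl | hi0
  · simpa using hω
  · obtain rfl : i = 1 := by omega
    simpa using h1

/-- The operator `φ ↦ ∑_{y ≠ z} P(x, y) φ(y)`. -/
def taboo (z : S) (φ : S → ℝ≥0∞) (x : S) : ℝ≥0∞ := ∫⁻ y in {z}ᶜ, φ y ∂(P x)

/-- `E_x[φ(X_j); j < τ(z)]`. -/
def tabooExp (z x : S) (j : ℕ) (φ : S → ℝ≥0∞) : ℝ≥0∞ :=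
  ∫⁻ ω in notReturned z j, φ (ω j) ∂(lawFrom P x)

lemma tabooExp_zero (z x : S) (φ : S → ℝ≥0∞) : tabooExp P z x 0 φ = φ x := by
  rw [tabooExp, notReturned_zero, Measure.restrict_univ,
    ← lintegral_map (f := φ) .of_discrete (measurable_pi_apply 0), map_zero_chainLaw,
    lintegral_dirac]

/-- Conditioning on the last step; `tabooExp_succ'` conditions on the first one. Both express that
the killed chain has the powers of `taboo` as its semigroup. -/
lemma tabooExp_succ (z x : S) (j : ℕ) (φ : S → ℝ≥0∞) :
    tabooExp P z x (j + 1) φ = tabooExp P z x j (taboo P z φ) := by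
  have hm : MeasurableSet {ω : ℕ → S | ω (j + 1) ≠ z} :=
    (measurableSet_singleton z).compl.preimage (measurable_pi_apply (j + 1))
  have h := markov_lintegral P (Measure.dirac x) (determinedAt_notReturned z j)
    (Φ := fun ω => ({z}ᶜ : Set S).indicator φ (ω 1))
    ((Measurable.of_discrete (f := ({z}ᶜ : Set S).indicator φ)).comp (measurable_pi_apply 1))
  rw [tabooExp, tabooExp, notReturned_succ, Set.inter_comm, ← Measure.restrict_restrict hm,
    ← lintegral_indicator hm]
  refine h.trans (lintegral_congr fun ω => ?_)
  rw [← lintegral_map (f := ({z}ᶜ : Set S).indicator φ) .of_discrete (measurable_pi_apply 1),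
    map_one_lawFrom, lintegral_indicator (measurableSet_singleton z).compl, taboo]

lemma tabooExp_succ' (z x : S) (j : ℕ) (φ : S → ℝ≥0∞) :
    tabooExp P z x (j + 1) φ = ∫⁻ y in {z}ᶜ, tabooExp P z y j φ ∂(P x) := by
  induction j generalizing φ with
  | zero => rw [tabooExp_succ, tabooExp_zero, taboo]; simp only [tabooExp_zero]
  | succ j ih => rw [tabooExp_succ, ih]; simp only [tabooExp_succ]

lemma tabooExp_mono (z x : S) (j : ℕ) {φ ψ : S → ℝ≥0∞} (h : ∀ y, φ y ≤ ψ y) :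
    tabooExp P z x j φ ≤ tabooExp P z x j ψ := lintegral_mono fun _ => h _

lemma tabooExp_mono_ne (z x : S) (j : ℕ) {φ ψ : S → ℝ≥0∞} (h : ∀ y, y ≠ z → φ y ≤ ψ y) :
    tabooExp P z x (j + 1) φ ≤ tabooExp P z x (j + 1) ψ :=
  setLIntegral_mono_ae' (measurableSet_notReturned z _) <| .of_forall fun _ hω =>
    h _ (mem_notReturned.1 hω _ (by omega) le_rfl)

lemma tabooExp_add (z x : S) (j : ℕ) (φ ψ : S → ℝ≥0∞) :
    tabooExp P z x j (fun y => φ y + ψ y) = tabooExp P z x j φ + tabooExp P z x j ψ :=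
  lintegral_add_left
    ((Measurable.of_discrete (f := φ)).comp (measurable_pi_apply j)) _

/-- The expected occupation measure `A ↦ E_x #{j < τ(z) : X_j ∈ A}`. -/
def occupation (z x : S) : Measure S :=
  Measure.sum fun j => ((lawFrom P x).restrict (notReturned z j)).map (fun ω => ω j)

lemma lintegral_occupation (z x : S) (φ : S → ℝ≥0∞) :
    ∫⁻ y, φ y ∂(occupation P z x) = ∑' j, tabooExp P z x j φ := by
  rw [occupation, lintegral_sum_measure]
  exact tsum_congr fun j => lintegral_map .of_discrete (measurable_pi_apply j)

/-- The drift inequality bounds the expected cost up to the return time. -/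
lemma lintegral_occupation_le_of_drift {z : S} {H v : S → ℝ≥0∞}
    (hd : ∀ x, x ≠ z → (∫⁻ y, v y ∂(P x)) + H x ≤ v x) (x : S) :
    ∫⁻ y, H y ∂(occupation P z x) ≤ H x + ∫⁻ y, v y ∂(P x) := by
  rw [lintegral_occupation, tsum_eq_zero_add' ENNReal.summable, tabooExp_zero]
  gcongr
  -- The initial term is kept apart because `x` may be `z`, where no drift is assumed. At times `1 ≤
  -- j < τ(z)` the chain is off `z`, so the drift applies there.
  have hT : ∀ x, taboo P z v x ≤ ∫⁻ y, v y ∂(P x) := fun x => setLIntegral_le_lintegral _ _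
  refine le_trans ?_ (hT x)
  have key : ∀ n, (∑ j ∈ Finset.range n, tabooExp P z x (j + 1) H) + tabooExp P z x (n + 1) v
      ≤ taboo P z v x := by
    intro n
    induction n with
    | zero => rw [Finset.sum_range_zero, zero_add, tabooExp_succ, tabooExp_zero]
    | succ n ih =>
      refine le_trans ?_ ih
      rw [Finset.sum_range_succ, add_assoc]
      gcongr
      rw [tabooExp_succ P z x (n + 1), ← tabooExp_add]
      refine tabooExp_mono_ne P z x n fun y hy => ?_
      rw [add_comm]
      exact le_trans (by gcongr; exact hT y) (hd y hy)
  exact ENNReal.tsum_le_of_sum_range_le fun n => le_self_add.trans (key n)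

/-- The event `{j < τ(z)}` belongs to the past at time `j`, so the Markov property applies to each
summand. -/
lemma tsum_shift_eq_lintegral_occupation (z x : S) {Φ : (ℕ → S) → ℝ≥0∞} (hΦ : Measurable Φ) :
    ∑' j, ∫⁻ ω in notReturned z j, Φ (shift j ω) ∂(lawFrom P x)
      = ∫⁻ y, (∫⁻ ω, Φ ω ∂(lawFrom P y)) ∂(occupation P z x) := by
  rw [lintegral_occupation]
  exact tsum_congr fun j => markov_lintegral P _ (determinedAt_notReturned z j) hΦ

omit [MeasurableSpace S] [Countable S] [DiscreteMeasurableSpace S] in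
lemma absCycleSum_eq (h : S → ℝ) (z : S) (ω : ℕ → S) :
    absCycleSum h z ω = ∑' j, (notReturned z j).indicator (fun ω => ‖h (ω j)‖ₑ) ω := by
  rw [absCycleSum]
  refine tsum_congr fun j => ?_
  by_cases hj : (j : ℕ∞) < returnTime z ω
  · rw [if_pos hj, Set.indicator_of_mem (show ω ∈ notReturned z j from hj)]
  · rw [if_neg hj, Set.indicator_of_notMem (show ω ∉ notReturned z j from hj)]

lemma measurable_coord_comp {β : Type*} [MeasurableSpace β] (g : S → β) (j : ℕ) :
    Measurable fun ω : ℕ → S => g (ω j) :=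
  (Measurable.of_discrete (f := g)).comp (measurable_pi_apply j)

lemma measurable_absCycleSum (h : S → ℝ) (z : S) : Measurable (absCycleSum h z) := by
  rw [funext (absCycleSum_eq h z)]
  exact Measurable.tsum fun j =>
    (measurable_coord_comp (fun y => ‖h y‖ₑ) j).indicator (measurableSet_notReturned z j)

lemma lintegral_absCycleSum (h : S → ℝ) (z x : S) :
    ∫⁻ ω, absCycleSum h z ω ∂(lawFrom P x) = ∫⁻ y, ‖h y‖ₑ ∂(occupation P z x) := by
  rw [lintegral_congr fun ω => absCycleSum_eq h z ω, lintegral_tsum, lintegral_occupation]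
  · exact tsum_congr fun j => lintegral_indicator (measurableSet_notReturned z j) _
  · exact fun j => ((measurable_coord_comp (fun y => ‖h y‖ₑ) j).indicator
      (measurableSet_notReturned z j)).aemeasurable

omit [MeasurableSpace S] [Countable S] [DiscreteMeasurableSpace S] in
lemma toENNReal_returnTime (z : S) (ω : ℕ → S) :
    (returnTime z ω : ℝ≥0∞) = ∑' j, (notReturned z j).indicator (fun _ => 1) ω := by
  have h1 : ∀ j, (notReturned z j).indicator (fun _ => (1 : ℝ≥0∞)) ω
      = if (j : ℕ∞) < returnTime z ω then 1 else 0 := fun j => by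
    by_cases hj : (j : ℕ∞) < returnTime z ω
    · rw [if_pos hj, Set.indicator_of_mem (show ω ∈ notReturned z j from hj)]
    · rw [if_neg hj, Set.indicator_of_notMem (show ω ∉ notReturned z j from hj)]
  rw [tsum_congr h1]
  induction returnTime z ω with
  | top => simp
  | coe n =>
    rw [tsum_eq_sum (s := Finset.range n)]
    · rw [Finset.sum_congr rfl fun j hj => if_pos (by exact_mod_cast Finset.mem_range.1 hj)]
      simp
    · intro j hj
      rw [if_neg]
      exact_mod_cast fun h => hj (Finset.mem_range.2 h)

lemma meanReturnTime_eq (z x : S) : meanReturnTime P x z = occupation P z x Set.univ := by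
  rw [meanReturnTime, lintegral_congr fun ω => toENNReal_returnTime z ω, lintegral_tsum,
    ← lintegral_one, lintegral_occupation]
  · exact tsum_congr fun j => lintegral_indicator (measurableSet_notReturned z j) _
  · exact fun j => (measurable_const.indicator (measurableSet_notReturned z j)).aemeasurable

/-- `E_x (∑_{j < τ(z)} |h(X_j)|)² ≤ 2 E_x ∑_{j < τ(z)} |h(X_j)| E_{X_j} ∑_{l < τ(z)} |h(X_l)|`. -/
lemma lintegral_absCycleSum_sq_le (h : S → ℝ) (z x : S) :
    ∫⁻ ω, absCycleSum h z ω ^ 2 ∂(lawFrom P x)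
      ≤ 2 * ∫⁻ y, ‖h y‖ₑ * (∫⁻ ω, absCycleSum h z ω ∂(lawFrom P y)) ∂(occupation P z x) := by
  -- Each ordered pair of times is charged to its earlier member. Counting the diagonal twice avoids
  -- subtraction in `ℝ≥0∞`.
  have hsq : ∀ c : ℕ → ℝ≥0∞, (∑' j, c j) ^ 2 ≤ 2 * ∑' j, c j * ∑' l, c (j + l) := by
    intro c
    have h1 : ∀ j l, c j * c l ≤ (if j ≤ l then c j * c l else 0)
        + (if l ≤ j then c l * c j else 0) := by
      intro j l
      rcases le_total j l with h | h
      · rw [if_pos h]; exact le_self_add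
      · rw [if_pos h, mul_comm]; exact le_add_self
    have h2 : ∀ j, ∑' l, (if j ≤ l then c j * c l else 0) = c j * ∑' l, c (j + l) := by
      intro j
      rw [← Summable.sum_add_tsum_nat_add' (f := fun l => if j ≤ l then c j * c l else 0) (k := j)
          ENNReal.summable,
        Finset.sum_eq_zero, zero_add, ← ENNReal.tsum_mul_left]
      · exact tsum_congr fun l => by rw [if_pos (by omega), add_comm l j]
      · intro l hl
        rw [if_neg (by simpa using hl)]
    calc (∑' j, c j) ^ 2 = ∑' j, ∑' l, c j * c l := by
          rw [sq, ← ENNReal.tsum_mul_right]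
          exact tsum_congr fun j => ENNReal.tsum_mul_left.symm
      _ ≤ ∑' j, ∑' l, ((if j ≤ l then c j * c l else 0) + (if l ≤ j then c l * c j else 0)) :=
          ENNReal.tsum_le_tsum fun j => ENNReal.tsum_le_tsum fun l => h1 j l
      _ = ∑' j, ∑' l, (if j ≤ l then c j * c l else 0)
            + ∑' j, ∑' l, (if l ≤ j then c l * c j else 0) := by
          rw [← ENNReal.tsum_add]
          exact tsum_congr fun j => ENNReal.tsum_add
      _ = _ := by
          rw [ENNReal.tsum_comm (f := fun j l => if l ≤ j then c l * c j else 0), two_mul]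
          simp only [h2]
  have hpath : ∀ ω, absCycleSum h z ω ^ 2 ≤
      2 * ∑' j, (notReturned z j).indicator
        (fun ω => ‖h (ω j)‖ₑ * absCycleSum h z (shift j ω)) ω := by
    intro ω
    rw [absCycleSum_eq]
    refine (hsq _).trans ?_
    gcongr with j
    by_cases hj : ω ∈ notReturned z j
    · rw [Set.indicator_of_mem hj, Set.indicator_of_mem hj, absCycleSum_eq]
      gcongr with l
      by_cases hl : ω ∈ notReturned z (j + l)
      · have : shift j ω ∈ notReturned z l := mem_notReturned.2 fun i h1 h2 =>
          mem_notReturned.1 hl _ (by omega) (by omega)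
        rw [Set.indicator_of_mem hl, Set.indicator_of_mem this]
        rfl
      · rw [Set.indicator_of_notMem hl]; exact zero_le
    · rw [Set.indicator_of_notMem hj, zero_mul]; exact zero_le
  have hm : Measurable fun ω : ℕ → S => ‖h (ω 0)‖ₑ * absCycleSum h z ω :=
    (measurable_coord_comp (fun y => ‖h y‖ₑ) 0).mul (measurable_absCycleSum h z)
  have hm' : ∀ j, Measurable fun ω : ℕ → S => ‖h (ω j)‖ₑ * absCycleSum h z (shift j ω) := fun j =>
    hm.comp (measurable_shift j)
  refine (lintegral_mono hpath).trans ?_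
  rw [lintegral_const_mul _ (Measurable.tsum fun j =>
    (hm' j).indicator (measurableSet_notReturned z j)), lintegral_tsum fun j =>
    ((hm' j).indicator (measurableSet_notReturned z j)).aemeasurable]
  gcongr
  have h3 := tsum_shift_eq_lintegral_occupation P z x hm
  simp only [lintegral_indicator (measurableSet_notReturned z _)]
  refine h3.le.trans (lintegral_mono fun y => ?_)
  rw [← lintegral_const_mul _ (measurable_absCycleSum h z)]
  refine lintegral_mono_ae ?_
  filter_upwards [ae_zero_eq P y] with ω hω
  rw [hω]

end

/-! ### From a drift off a finite set to a drift off one state -/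

section

variable {S : Type*} [MeasurableSpace S]

variable [Countable S] [DiscreteMeasurableSpace S]
variable (P : Kernel S S) [IsMarkovKernel P]

lemma tabooExp_one_eq (z x : S) (n : ℕ) :
    tabooExp P z x n 1 = lawFrom P x (notReturned z n) := by
  simp [tabooExp]

lemma tabooExp_one_le (z x : S) (n : ℕ) : tabooExp P z x n 1 ≤ 1 := by
  rw [tabooExp_one_eq]; exact prob_le_one

lemma lintegral_indicator_tabooExp_one (z x : S) (n : ℕ) :
    ∫⁻ y, ({z}ᶜ : Set S).indicator (fun y => tabooExp P z y n 1) y ∂(P x)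
      = tabooExp P z x (n + 1) 1 := by
  rw [tabooExp_succ', lintegral_indicator (measurableSet_singleton z).compl]

/-- A state that leads to `z` in `n` steps has a positive probability of hitting `z` by time
`n`. -/
lemma tabooExp_one_lt_one {z : S} (n : ℕ) {x : S} (hx : x ≠ z) (hpos : 0 < (P ^ n) x {z}) :
    tabooExp P z x n 1 < 1 := by
  induction n generalizing x with
  | zero =>
    rw [pow_zero] at hpos
    have : (1 : Kernel S S) x {z} = 0 := by
      change (Kernel.id x) {z} = 0
      rw [Kernel.id_apply, Measure.dirac_apply' _ (measurableSet_singleton z),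
        Set.indicator_of_notMem (by simpa using hx)]
    exact absurd this hpos.ne'
  | succ n ih =>
    refine lt_of_le_of_ne (tabooExp_one_le P z x _) fun h => hpos.ne' ?_
    rw [add_comm n 1, Kernel.pow_add_apply_eq_lintegral _ _ _ _ (measurableSet_singleton z)]
    set q : S → ℝ≥0∞ := ({z}ᶜ : Set S).indicator fun y => tabooExp P z y n 1 with hq
    have hq1 : ∀ y, q y ≤ 1 := fun y =>
      (Set.indicator_le_self _ _ _).trans (tabooExp_one_le P z y n)
    have hint : ∫⁻ y, q y ∂(P x) = 1 := (lintegral_indicator_tabooExp_one P z x n).trans h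
    -- If `z` were almost surely avoided through time `n + 1`, then after one step it would almost
    -- surely still be avoided for `n` more steps. By induction no such state leads to `z` in `n`
    -- steps.
    have hae : q =ᵐ[P x] fun _ => 1 := by
      refine ae_eq_of_ae_le_of_lintegral_le (.of_forall hq1) (by simp [hint])
        aemeasurable_const (by simp [hint])
    rw [pow_one]
    refine (lintegral_congr_ae ?_).trans lintegral_zero
    filter_upwards [hae] with y hy
    have hyz : y ≠ z := by
      rintro rfl
      rw [hq, Set.indicator_of_notMem (by simp)] at hy
      exact zero_ne_one hy
    rw [hq, Set.indicator_of_mem (by simpa using hyz)] at hy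
    by_contra h0
    exact (ih hyz (pos_iff_ne_zero.2 h0)).ne hy

-- Let `p n y = P_y(τ(z) > n)`, set to zero at `y = z`. One step of the chain turns `p n` into `p (n
-- + 1)`, so the drift of `∑_{n < L} p n` telescopes to `1 - p L x`. This is nonnegative everywhere
-- off `z`, and positive at `k` when `k` leads to `z` in `L` steps. Scaling by `M / (1 - p L k)`
-- gives drift `M` at `k`.
open Classical in
lemma exists_bounded_drift_singleton (hirr : Kernel.IsIrreducible Measure.count P) (z k : S)
    (M : ℝ≥0) : ∃ (w : S → ℝ≥0) (C : ℝ≥0), (∀ x, w x ≤ C) ∧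
      ∀ x, x ≠ z → (∫⁻ y, (w y : ℝ≥0∞) ∂(P x)) + (if x = k then (M : ℝ≥0∞) else 0) ≤ w x := by
  by_cases hk : k = z
  · refine ⟨0, 0, by simp, fun x hx => ?_⟩
    rw [if_neg (by rintro rfl; exact hx hk)]
    simp
  obtain ⟨L, hL⟩ := hirr.irreducible (measurableSet_singleton z) (by simp) k
  have hlt := tabooExp_one_lt_one P L hk hL
  set p : ℕ → S → ℝ≥0∞ := fun n y => tabooExp P z y n 1 with hp
  set q : ℕ → S → ℝ≥0∞ := fun n => ({z}ᶜ : Set S).indicator (p n) with hq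
  have hq1 : ∀ n y, q n y ≤ 1 := fun n y =>
    (Set.indicator_le_self _ _ _).trans (tabooExp_one_le P z y n)
  set δ : ℝ≥0 := (1 - p L k).toNNReal with hδ
  have hδc : (δ : ℝ≥0∞) = 1 - p L k := ENNReal.coe_toNNReal (by simp)
  have hδ0 : δ ≠ 0 := by
    intro h0
    rw [h0, ENNReal.coe_zero, eq_comm, tsub_eq_zero_iff_le] at hδc
    exact absurd hlt (not_lt.2 hδc)
  set A : ℝ≥0 := M / δ with hA
  set w : S → ℝ≥0 := fun y => A * ∑ n ∈ Finset.range L, (q n y).toNNReal with hw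
  have hwc : ∀ y, (w y : ℝ≥0∞) = A * ∑ n ∈ Finset.range L, q n y := by
    intro y
    rw [hw]
    push_cast
    congr 1
    exact Finset.sum_congr rfl fun n _ =>
      ENNReal.coe_toNNReal ((hq1 n y).trans_lt ENNReal.one_lt_top).ne
  refine ⟨w, A * L, fun y => ?_, fun x hx => ?_⟩
  · rw [hw]
    dsimp only
    gcongr
    calc ∑ n ∈ Finset.range L, (q n y).toNNReal ≤ ∑ n ∈ Finset.range L, 1 :=
          Finset.sum_le_sum fun n _ => ENNReal.toNNReal_mono ENNReal.one_ne_top (hq1 n y)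
      _ = L := by simp
  · have hPw : ∫⁻ y, (w y : ℝ≥0∞) ∂(P x) = A * ∑ n ∈ Finset.range L, p (n + 1) x := by
      rw [lintegral_congr hwc, lintegral_const_mul _ .of_discrete,
        lintegral_finsetSum _ fun _ _ => .of_discrete]
      congr 1
      exact Finset.sum_congr rfl fun n _ => lintegral_indicator_tabooExp_one P z x n
    have hwx : (w x : ℝ≥0∞) = A * ∑ n ∈ Finset.range L, p n x := by
      rw [hwc]
      congr 1
      exact Finset.sum_congr rfl fun n _ => Set.indicator_of_mem (by simpa using hx) _
    have hp0 : p 0 x = 1 := by simp [hp, tabooExp_zero]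
    have htel : (∑ n ∈ Finset.range L, p (n + 1) x) + 1 = (∑ n ∈ Finset.range L, p n x) + p L x := by
      rw [← Finset.sum_range_succ, Finset.sum_range_succ', hp0]
    have hpL : p L x ≤ 1 := tabooExp_one_le P z x L
    have htel2 : (∑ n ∈ Finset.range L, p (n + 1) x) + (1 - p L x)
        = ∑ n ∈ Finset.range L, p n x := by
      have hne : p L x ≠ ∞ := (hpL.trans_lt ENNReal.one_lt_top).ne
      refine (ENNReal.add_left_inj hne).1 ?_
      rw [← htel, add_assoc, tsub_add_cancel_of_le hpL]
    rw [hPw, hwx, ← htel2, mul_add]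
    gcongr
    split_ifs with hxk
    · rw [hxk, ← hδc, ← ENNReal.coe_mul, hA, div_mul_cancel₀ _ hδ0]
    · exact zero_le

open Classical in
lemma exists_bounded_drift (hirr : Kernel.IsIrreducible Measure.count P) (z : S) (K : Finset S)
    (M : ℝ≥0) : ∃ (w : S → ℝ≥0) (C : ℝ≥0), (∀ x, w x ≤ C) ∧
      ∀ x, x ≠ z → (∫⁻ y, (w y : ℝ≥0∞) ∂(P x)) + (if x ∈ K then (M : ℝ≥0∞) else 0) ≤ w x := by
  induction K using Finset.induction_on with
  | empty => exact ⟨0, 0, by simp, by simp⟩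
  | insert k K hk ih =>
    obtain ⟨w, C, hw, hd⟩ := ih
    obtain ⟨w', C', hw', hd'⟩ := exists_bounded_drift_singleton P hirr z k M
    refine ⟨w + w', C + C', fun x => add_le_add (hw x) (hw' x), fun x hx => ?_⟩
    have h1 : (if x ∈ insert k K then (M : ℝ≥0∞) else 0)
        ≤ (if x ∈ K then (M : ℝ≥0∞) else 0) + (if x = k then (M : ℝ≥0∞) else 0) := by
      by_cases h1 : x ∈ K <;> by_cases h2 : x = k <;> simp [h1, h2]
    simp only [Pi.add_apply, ENNReal.coe_add]
    rw [lintegral_add_left .of_discrete]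
    refine (add_le_add_right h1 _).trans ?_
    rw [add_add_add_comm]
    exact add_le_add (hd x hx) (hd' x hx)

/-- A Foster–Lyapunov drift off a finite set can be turned into a drift off a single state. -/
lemma exists_drift_singleton (hirr : Kernel.IsIrreducible Measure.count P) (K : Finset S)
    {H : S → ℝ≥0∞} (hH : ∀ x, H x < ∞) {v : S → ℝ≥0}
    (hK : ∀ x ∈ K, ∫⁻ y, (v y : ℝ≥0∞) ∂(P x) < ∞)
    (hv : ∀ x ∉ K, (∫⁻ y, (v y : ℝ≥0∞) ∂(P x)) + H x ≤ v x) (z : S) :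
    ∃ (v' : S → ℝ≥0) (C : ℝ≥0), (∀ x, v' x ≤ v x + C) ∧ (∀ x, ∫⁻ y, (v' y : ℝ≥0∞) ∂(P x) < ∞) ∧
      ∀ x, x ≠ z → (∫⁻ y, (v' y : ℝ≥0∞) ∂(P x)) + H x ≤ v' x := by
  have hPv : ∀ x, ∫⁻ y, (v y : ℝ≥0∞) ∂(P x) < ∞ := by
    intro x
    by_cases hx : x ∈ K
    · exact hK x hx
    · exact (le_self_add.trans (hv x hx)).trans_lt ENNReal.coe_lt_top
  -- `M` dominates all that has to be compensated on the finite set `K`; the correction `w` with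
  -- drift `M` there takes care of it. That `w` is bounded yields `v' ≤ v + C`.
  obtain ⟨M, hM⟩ : ∃ M : ℝ≥0, ∀ x ∈ K, (∫⁻ y, (v y : ℝ≥0∞) ∂(P x)) + H x ≤ M := by
    refine ⟨(∑ x ∈ K, ((∫⁻ y, (v y : ℝ≥0∞) ∂(P x)) + H x)).toNNReal, fun x hx => ?_⟩
    rw [ENNReal.coe_toNNReal (ENNReal.sum_lt_top.2 fun x _ =>
      ENNReal.add_lt_top.2 ⟨hPv x, hH x⟩).ne]
    exact Finset.single_le_sum (f := fun x => (∫⁻ y, (v y : ℝ≥0∞) ∂(P x)) + H x)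
      (fun _ _ => zero_le) hx
  obtain ⟨w, C, hw, hd⟩ := exists_bounded_drift P hirr z K M
  have hP : ∀ x, ∫⁻ y, ((v y + w y : ℝ≥0) : ℝ≥0∞) ∂(P x)
      = (∫⁻ y, (v y : ℝ≥0∞) ∂(P x)) + ∫⁻ y, (w y : ℝ≥0∞) ∂(P x) := by
    intro x
    simp only [ENNReal.coe_add]
    rw [lintegral_add_left .of_discrete]
  refine ⟨fun x => v x + w x, C, fun x => add_le_add_right (hw x) _, fun x => ?_, fun x hx => ?_⟩
  · rw [hP]
    refine ENNReal.add_lt_top.2 ⟨hPv x, ?_⟩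
    calc ∫⁻ y, (w y : ℝ≥0∞) ∂(P x) ≤ ∫⁻ y, (C : ℝ≥0∞) ∂(P x) :=
          lintegral_mono fun y => ENNReal.coe_le_coe.2 (hw y)
      _ < ∞ := by simp
  · rw [hP, ENNReal.coe_add]
    have h := hd x hx
    by_cases hxK : x ∈ K
    · rw [if_pos hxK] at h
      calc _ = (∫⁻ y, (w y : ℝ≥0∞) ∂(P x)) + ((∫⁻ y, (v y : ℝ≥0∞) ∂(P x)) + H x) := by ring
        _ ≤ (∫⁻ y, (w y : ℝ≥0∞) ∂(P x)) + M := by gcongr; exact hM x hxK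
        _ ≤ w x := h
        _ ≤ _ := le_add_self
    · rw [if_neg hxK, add_zero] at h
      rw [add_right_comm]
      exact add_le_add (hv x hxK) h

/-- The two drift inequalities make the first two moments of the cycle costs finite. -/
lemma occupation_moments_lt_top (hirr : Kernel.IsIrreducible Measure.count P) (K : Finset S)
    {H : S → ℝ≥0∞} (hH : ∀ x, H x < ∞) {v₁ v₂ : S → ℝ≥0}
    (hK₁ : ∀ x ∈ K, ∫⁻ y, (v₁ y : ℝ≥0∞) ∂(P x) < ∞)
    (hK₂ : ∀ x ∈ K, ∫⁻ y, (v₂ y : ℝ≥0∞) ∂(P x) < ∞)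
    (hv₁ : ∀ x ∉ K, (∫⁻ y, (v₁ y : ℝ≥0∞) ∂(P x)) + H x ≤ v₁ x)
    (hv₂ : ∀ x ∉ K, (∫⁻ y, (v₂ y : ℝ≥0∞) ∂(P x)) + H x * v₁ x ≤ v₂ x) (z x : S) :
    ∫⁻ y, H y ∂(occupation P z x) < ∞ ∧
      ∫⁻ y, H y * (∫⁻ y', H y' ∂(occupation P z y)) ∂(occupation P z x) < ∞ := by
  obtain ⟨u₁, C, hu₁, hPu₁, hd₁⟩ := exists_drift_singleton P hirr K hH hK₁ hv₁ z
  obtain ⟨u₂, -, -, hPu₂, hd₂⟩ := exists_drift_singleton P hirr K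
    (H := fun x => H x * v₁ x) (fun x => ENNReal.mul_lt_top (hH x) ENNReal.coe_lt_top) hK₂ hv₂ z
  have hU : ∀ x, ∫⁻ y, H y ∂(occupation P z x) ≤ H x + ∫⁻ y, (u₁ y : ℝ≥0∞) ∂(P x) :=
    lintegral_occupation_le_of_drift P hd₁
  have hUlt : ∀ x, ∫⁻ y, H y ∂(occupation P z x) < ∞ := fun x =>
    (hU x).trans_lt (ENNReal.add_lt_top.2 ⟨hH x, hPu₁ x⟩)
  refine ⟨hUlt x, ?_⟩
  -- Off `z` the expected cost `U` satisfies `U ≤ u₁ ≤ v₁ + C`, so `H U ≤ H v₁ + C H`. The first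
  -- term is paid by `u₂`, the second by `C u₁`.
  have hd : ∀ x, x ≠ z → (∫⁻ y, ((u₂ y : ℝ≥0∞) + C * u₁ y) ∂(P x))
      + H x * (∫⁻ y', H y' ∂(occupation P z x)) ≤ u₂ x + C * u₁ x := by
    intro x hx
    have h1 : ∫⁻ y', H y' ∂(occupation P z x) ≤ v₁ x + C := by
      refine (hU x).trans ?_
      rw [add_comm]
      exact (hd₁ x hx).trans (by exact_mod_cast hu₁ x)
    rw [lintegral_add_left .of_discrete, lintegral_const_mul _ .of_discrete]
    calc _ ≤ (∫⁻ y, (u₂ y : ℝ≥0∞) ∂(P x)) + C * (∫⁻ y, (u₁ y : ℝ≥0∞) ∂(P x))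
          + H x * (v₁ x + C) := by gcongr
      _ = ((∫⁻ y, (u₂ y : ℝ≥0∞) ∂(P x)) + H x * v₁ x)
          + C * ((∫⁻ y, (u₁ y : ℝ≥0∞) ∂(P x)) + H x) := by ring
      _ ≤ _ := by gcongr; exacts [hd₂ x hx, hd₁ x hx]
  refine (lintegral_occupation_le_of_drift P hd x).trans_lt (ENNReal.add_lt_top.2 ⟨?_, ?_⟩)
  · exact ENNReal.mul_lt_top (hH x) (hUlt x)
  · rw [lintegral_add_left .of_discrete, lintegral_const_mul _ .of_discrete]
    exact ENNReal.add_lt_top.2 ⟨hPu₂ x, ENNReal.mul_lt_top ENNReal.coe_lt_top (hPu₁ x)⟩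

end

/-! ### The stationary distribution as a normalized cycle occupation measure -/

section

variable {S : Type*} [MeasurableSpace S]

open scoped Topology

variable [Countable S] [DiscreteMeasurableSpace S]
variable (P : Kernel S S) [IsMarkovKernel P]

lemma occupation_univ (z x : S) : occupation P z x Set.univ = ∑' j, tabooExp P z x j 1 := by
  rw [← lintegral_one, lintegral_occupation]; rfl

lemma occupation_apply (z x : S) (s : Set S) :
    occupation P z x s = ∑' j, tabooExp P z x j (s.indicator 1) := by
  rw [← lintegral_occupation, lintegral_indicator_one .of_discrete]

lemma one_le_occupation_univ (z x : S) : 1 ≤ occupation P z x Set.univ := by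
  rw [occupation_univ]
  refine le_trans ?_ (ENNReal.le_tsum 0)
  rw [tabooExp_zero]; rfl

lemma tabooExp_const_mul (z x : S) (j : ℕ) (c : ℝ≥0∞) (φ : S → ℝ≥0∞) :
    tabooExp P z x j (fun y => c * φ y) = c * tabooExp P z x j φ :=
  lintegral_const_mul _ (measurable_coord_comp φ j)

lemma lintegral_eq_taboo_add (z : S) (φ : S → ℝ≥0∞) (μ : Measure S) :
    ∫⁻ y, φ y ∂μ = (∫⁻ y in {z}ᶜ, φ y ∂μ) + φ z * μ {z} := by
  rw [← lintegral_add_compl _ (measurableSet_singleton z), lintegral_singleton, add_comm]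

/-- The step after time `j` either avoids `z`, and the cycle goes on, or lands at `z`, where `φ` has
the value `φ z`. -/
lemma tabooExp_lintegral (z x : S) (j : ℕ) (φ : S → ℝ≥0∞) :
    tabooExp P z x j (fun y => ∫⁻ y', φ y' ∂(P y))
      = tabooExp P z x (j + 1) φ + φ z * tabooExp P z x j (fun y => P y {z}) := by
  rw [tabooExp_succ, ← tabooExp_const_mul, ← tabooExp_add]
  congr 1
  ext y
  exact lintegral_eq_taboo_add z φ (P y)

section Finite

variable {P} (hfin : ∀ z x, occupation P z x Set.univ < ∞)
include hfin

/-- The `j`-th term is `P_x(τ(z) = j + 1) = P_x(τ(z) > j) - P_x(τ(z) > j + 1)`. The sum telescopes,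
and finiteness of `E_x τ(z)` permits the cancellation. -/
lemma tsum_tabooExp_hit (z x : S) : ∑' j, tabooExp P z x j (fun y => P y {z}) = 1 := by
  have h1 : ∀ j, tabooExp P z x j 1
      = tabooExp P z x (j + 1) 1 + tabooExp P z x j (fun y => P y {z}) := by
    intro j
    have := tabooExp_lintegral P z x j 1
    simp only [Pi.one_apply, lintegral_one, measure_univ, one_mul] at this
    exact this
  have h2 : ∑' j, tabooExp P z x j 1 = 1 + ∑' j, tabooExp P z x (j + 1) 1 := by
    rw [tsum_eq_zero_add' ENNReal.summable, tabooExp_zero]; rfl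
  have h3 : ∑' j, tabooExp P z x j 1
      = ∑' j, tabooExp P z x (j + 1) 1 + ∑' j, tabooExp P z x j (fun y => P y {z}) := by
    rw [← ENNReal.tsum_add]; exact tsum_congr h1
  have h4 : ∑' j, tabooExp P z x (j + 1) 1 ≠ ∞ := by
    have := hfin z x
    rw [occupation_univ, h2] at this
    exact (le_add_self.trans_lt this).ne
  rw [h3, add_comm] at h2
  exact (ENNReal.add_left_inj h4).1 h2

/-- Applying `P` moves the window of times from `0, …, τ - 1` to `1, …, τ`. Nothing changes, since
the path is at `z` at both ends. -/
lemma invariant_occupation (z : S) : Kernel.Invariant P (occupation P z z) := by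
  refine Measure.ext fun s hs => ?_
  rw [Measure.bind_apply hs P.measurable.aemeasurable, lintegral_occupation, occupation_apply]
  have h1 : ∀ y, P y s = ∫⁻ y', s.indicator 1 y' ∂(P y) := fun y =>
    (lintegral_indicator_one hs).symm
  simp only [h1, tabooExp_lintegral]
  rw [ENNReal.tsum_add, ENNReal.tsum_mul_left, tsum_tabooExp_hit hfin, mul_one,
    tsum_eq_zero_add' (f := fun j => tabooExp P z z j (s.indicator 1)) ENNReal.summable,
    tabooExp_zero, add_comm]

/-- Every stationary distribution is the normalized occupation measure of a cycle. -/
lemma eq_occupation_of_stationary {π : Measure S} (hπ : IsStationaryDistribution P π) (z : S) :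
    π = (occupation P z z Set.univ)⁻¹ • occupation P z z := by
  have := hπ.1
  have hinv : ∀ φ : S → ℝ≥0∞, ∫⁻ x, (∫⁻ y, φ y ∂(P x)) ∂π = ∫⁻ x, φ x ∂π := by
    intro φ
    conv_rhs => rw [← hπ.2.def]
    exact (Measure.lintegral_bind P.measurable.aemeasurable
      (Measurable.of_discrete (f := φ)).aemeasurable).symm
  -- Decomposition of the stationary chain at its last visit to `z` among the times `0, …, n`; the
  -- remainder is the contribution of no visit.
  have hdec : ∀ (φ : S → ℝ≥0∞) (n : ℕ), ∫⁻ x, φ x ∂π =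
      (∑ j ∈ Finset.range (n + 1), tabooExp P z z j φ) * π {z}
        + ∫⁻ x in {z}ᶜ, tabooExp P z x n φ ∂π := by
    intro φ n
    induction n with
    | zero =>
      simp only [zero_add, Finset.sum_range_one, tabooExp_zero]
      rw [lintegral_eq_taboo_add z, add_comm]
    | succ n ih =>
      rw [ih, Finset.sum_range_succ _ (n + 1), add_mul, add_assoc]
      congr 1
      rw [← lintegral_indicator (measurableSet_singleton z).compl, ← hinv]
      simp only [lintegral_indicator (measurableSet_singleton z).compl, ← tabooExp_succ']
      rw [lintegral_eq_taboo_add z, add_comm]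
  have hlim : ∀ s : Set S, Tendsto
      (fun n => ∫⁻ x in {z}ᶜ, tabooExp P z x n (s.indicator 1) ∂π) atTop (𝓝 0) := by
    intro s
    have hle : ∀ n x, tabooExp P z x n (s.indicator 1) ≤ tabooExp P z x n 1 := fun n x =>
      tabooExp_mono P z x n fun y => Set.indicator_le_self _ _ _
    rw [← lintegral_zero (μ := π.restrict {z}ᶜ)]
    refine tendsto_lintegral_of_dominated_convergence (fun _ => 1) (fun n => .of_discrete)
      (fun n => .of_forall fun x => (hle n x).trans (tabooExp_one_le P z x n)) (by simp)
      (.of_forall fun x => ?_)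
    refine tendsto_of_tendsto_of_tendsto_of_le_of_le tendsto_const_nhds
      (ENNReal.tendsto_atTop_zero_of_tsum_ne_top ?_) (fun n => zero_le) (fun n => hle n x)
    rw [← occupation_univ]
    exact (hfin z x).ne
  have hs : ∀ s : Set S, π s = occupation P z z s * π {z} := by
    intro s
    have h1 : Tendsto (fun n => (∑ j ∈ Finset.range (n + 1), tabooExp P z z j (s.indicator 1)) * π {z}
        + ∫⁻ x in {z}ᶜ, tabooExp P z x n (s.indicator 1) ∂π) atTop
        (𝓝 ((∑' j, tabooExp P z z j (s.indicator 1)) * π {z} + 0)) := by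
      refine Tendsto.add (ENNReal.Tendsto.mul_const ?_ (Or.inr (measure_ne_top _ _))) (hlim s)
      exact (ENNReal.tendsto_nat_tsum _).comp (tendsto_add_atTop_nat 1)
    simp only [← hdec, add_zero, ← occupation_apply] at h1
    rw [lintegral_indicator_one .of_discrete] at h1
    exact tendsto_nhds_unique tendsto_const_nhds h1
  -- Total mass one gives Kac's formula `π {z} = 1 / E_z τ(z)`.
  have huniv := hs Set.univ
  rw [measure_univ] at huniv
  have hz : π {z} = (occupation P z z Set.univ)⁻¹ :=
    ENNReal.eq_inv_of_mul_eq_one_left (by rw [mul_comm]; exact huniv.symm)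
  ext s -
  rw [hs s, Measure.smul_apply, smul_eq_mul, hz, mul_comm]

lemma isStationaryDistribution_occupation (z : S) :
    IsStationaryDistribution P ((occupation P z z Set.univ)⁻¹ • occupation P z z) := by
  have h0 : occupation P z z Set.univ ≠ 0 :=
    (zero_lt_one.trans_le (one_le_occupation_univ P z z)).ne'
  refine ⟨⟨?_⟩, ?_⟩
  · rw [Measure.smul_apply, smul_eq_mul, ENNReal.inv_mul_cancel h0 (hfin z z).ne]
  · have h := (invariant_occupation hfin z).def
    refine Measure.ext fun s hs => ?_
    have h2 := congrArg (fun m : Measure S => m s) h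
    beta_reduce at h2
    rw [Measure.bind_apply hs P.measurable.aemeasurable] at h2
    rw [Measure.bind_apply hs P.measurable.aemeasurable, lintegral_smul_measure, h2,
      Measure.smul_apply]

lemma ae_returnTime_lt_top (z x : S) : ∀ᵐ ω ∂(lawFrom P x), returnTime z ω < ⊤ := by
  have h : ∫⁻ ω, (returnTime z ω : ℝ≥0∞) ∂(lawFrom P x) ≠ ∞ := by
    have := meanReturnTime_eq P z x
    rw [meanReturnTime] at this
    rw [this]
    exact (hfin z x).ne
  have hm : Measurable fun ω : ℕ → S => (returnTime z ω : ℝ≥0∞) := by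
    rw [funext (toENNReal_returnTime z)]
    exact Measurable.tsum fun j => measurable_const.indicator (measurableSet_notReturned z j)
  filter_upwards [ae_lt_top hm h] with ω hω
  simpa using hω

end Finite

end

/-! ### First and second moments of cycle sums -/

section

variable {S : Type*} [MeasurableSpace S]

/-- `τ(z)` as a natural number, with value `0` if the path does not return to `z`. -/
def returnLen (z : S) (ω : ℕ → S) : ℕ := (returnTime z ω).toNat

omit [MeasurableSpace S] in
lemma mem_notReturned_iff_lt_returnLen {z : S} {ω : ℕ → S} (h : returnTime z ω < ⊤) {j : ℕ} :
    ω ∈ notReturned z j ↔ j < returnLen z ω := by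
  change (j : ℕ∞) < returnTime z ω ↔ _
  conv_lhs => rw [← ENat.natCast_toNat h.ne]
  rw [Nat.cast_lt]; rfl

omit [MeasurableSpace S] in
lemma mem_notReturned_of_lt_returnLen {z : S} {ω : ℕ → S} {j : ℕ} (hj : j < returnLen z ω) :
    ω ∈ notReturned z j := by
  have h : returnTime z ω < ⊤ := by
    refine lt_of_le_of_ne le_top fun h => ?_
    rw [returnLen, h] at hj
    simp at hj
  exact (mem_notReturned_iff_lt_returnLen h).2 hj

omit [MeasurableSpace S] in
lemma cycleSum_eq (h : S → ℝ) (z : S) (ω : ℕ → S) :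
    cycleSum h z ω = ∑ j ∈ Finset.range (returnLen z ω), h (ω j) := rfl

omit [MeasurableSpace S] in
lemma enorm_cycleSum_le (h : S → ℝ) (z : S) (ω : ℕ → S) :
    ‖cycleSum h z ω‖ₑ ≤ absCycleSum h z ω := by
  rw [cycleSum_eq, absCycleSum_eq]
  refine (enorm_sum_le _ _).trans (le_trans (Finset.sum_le_sum fun j hj => ?_)
    (ENNReal.sum_le_tsum (Finset.range (returnLen z ω))))
  rw [Set.indicator_of_mem (mem_notReturned_of_lt_returnLen (Finset.mem_range.1 hj))]

omit [MeasurableSpace S] in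
lemma shift_mem_notReturned_iff {z : S} {ω : ℕ → S} {j : ℕ} (hj : ω ∈ notReturned z j) (l : ℕ) :
    shift j ω ∈ notReturned z l ↔ ω ∈ notReturned z (j + l) := by
  simp only [mem_notReturned, shift]
  rw [mem_notReturned] at hj
  constructor
  · intro h i h1 h2
    rcases Nat.lt_or_ge j i with h3 | h3
    · have := h (i - j) (by omega) (by omega)
      rwa [Nat.add_sub_cancel' h3.le] at this
    · exact hj i h1 h3
  · exact fun h i h1 h2 => h _ (by omega) (by omega)

omit [MeasurableSpace S] in
lemma returnLen_shift {z : S} {ω : ℕ → S} (h : returnTime z ω < ⊤) {j : ℕ}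
    (hj : ω ∈ notReturned z j) : returnLen z (shift j ω) = returnLen z ω - j := by
  have hjL := (mem_notReturned_iff_lt_returnLen h).1 hj
  have hfin : returnTime z (shift j ω) < ⊤ := by
    have h1 : shift j ω ∉ notReturned z (returnLen z ω) := by
      rw [shift_mem_notReturned_iff hj, mem_notReturned_iff_lt_returnLen h]
      omega
    exact lt_of_le_of_lt (not_lt.1 h1) (ENat.natCast_lt_top _)
  refine le_antisymm (not_lt.1 fun h1 => ?_) (not_lt.1 fun h1 => ?_)
  · rw [← mem_notReturned_iff_lt_returnLen hfin, shift_mem_notReturned_iff hj,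
      mem_notReturned_iff_lt_returnLen h] at h1
    omega
  · have h2 : ω ∈ notReturned z (j + returnLen z (shift j ω)) :=
      (mem_notReturned_iff_lt_returnLen h).2 (by omega)
    rw [← shift_mem_notReturned_iff hj, mem_notReturned_iff_lt_returnLen hfin] at h2
    omega

omit [MeasurableSpace S] in
lemma tsum_notReturned_indicator {E : Type*} [AddCommMonoid E] [TopologicalSpace E]
    {z : S} {ω : ℕ → S} (h : returnTime z ω < ⊤) (g : ℕ → (ℕ → S) → E) :
    ∑' j, (notReturned z j).indicator (g j) ω = ∑ j ∈ Finset.range (returnLen z ω), g j ω := by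
  rw [tsum_eq_sum (s := Finset.range (returnLen z ω))]
  · exact Finset.sum_congr rfl fun j hj =>
      Set.indicator_of_mem (mem_notReturned_of_lt_returnLen (Finset.mem_range.1 hj)) _
  · intro j hj
    refine Set.indicator_of_notMem (fun h1 => hj (Finset.mem_range.2 ?_)) _
    exact (mem_notReturned_iff_lt_returnLen h).1 h1

/-- Pairs are grouped by their smaller index: twice the tail starting at `j`, minus the diagonal
term counted once too often. For a cycle, this tail is the cycle sum of the path shifted by `j`. -/
lemma sq_sum_range_eq (L : ℕ) (a : ℕ → ℝ) :
    (∑ j ∈ Finset.range L, a j) ^ 2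
      = ∑ j ∈ Finset.range L, a j * (2 * (∑ l ∈ Finset.range (L - j), a (j + l)) - a j) := by
  induction L generalizing a with
  | zero => simp
  | succ L ih =>
    rw [Finset.sum_range_succ', Finset.sum_range_succ' (fun j => a j * _)]
    have h1 := ih fun j => a (j + 1)
    simp only [Nat.sub_zero, zero_add, Nat.add_sub_add_right]
    rw [Finset.sum_range_succ' a]
    simp only [add_right_comm _ 1] at h1 ⊢
    rw [← h1]
    ring

variable [Countable S] [DiscreteMeasurableSpace S]
variable (P : Kernel S S) [IsMarkovKernel P]

@[fun_prop]
lemma measurable_returnLen (z : S) : Measurable (returnLen z) := by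
  have h : returnLen z = fun ω => ⌊(returnTime z ω : ℝ≥0∞).toReal⌋₊ := by
    ext ω
    rw [returnLen]
    induction returnTime z ω with
    | top => simp
    | coe n => simp
  have hm : Measurable fun ω : ℕ → S => (returnTime z ω : ℝ≥0∞) := by
    rw [funext (toENNReal_returnTime z)]
    exact Measurable.tsum fun j => measurable_const.indicator (measurableSet_notReturned z j)
  rw [h]
  exact Nat.measurable_floor.comp hm.ennreal_toReal

@[fun_prop]
lemma measurable_cycleSum (h : S → ℝ) (z : S) : Measurable (cycleSum h z) := by
  have h1 : Measurable fun p : ℕ × (ℕ → S) => ∑ j ∈ Finset.range p.1, h (p.2 j) :=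
    measurable_from_prod_countable_right fun n =>
      Finset.measurable_fun_sum (Finset.range n) fun j _ => measurable_coord_comp h j
  exact h1.comp ((measurable_returnLen z).prodMk measurable_id)

/-- The kernel `x ↦ P_x` on path space. -/
def lawKernel : Kernel S (ℕ → S) := ⟨lawFrom P, measurable_lawFrom P⟩

lemma sum_map_shift_eq (z x : S) :
    Measure.sum (fun j => ((lawFrom P x).restrict (notReturned z j)).map (shift j))
      = (occupation P z x).bind (lawKernel P) := by
  refine Measure.ext_of_lintegral _ fun Φ hΦ => ?_
  rw [lintegral_sum_measure, Measure.lintegral_bind (lawKernel P).measurable.aemeasurable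
    hΦ.aemeasurable]
  refine Eq.trans ?_ (tsum_shift_eq_lintegral_occupation P z x hΦ)
  exact tsum_congr fun j => lintegral_map hΦ (measurable_shift j)

/-- Signed version of `tsum_shift_eq_lintegral_occupation`: the identity of measures
`sum_map_shift_eq` carries it over to integrable functions by Fubini. -/
lemma integral_tsum_shift (z x : S) {Φ : (ℕ → S) → ℝ} (hΦ : Measurable Φ)
    (hint : ∫⁻ y, (∫⁻ ω, ‖Φ ω‖ₑ ∂(lawFrom P y)) ∂(occupation P z x) < ∞) :
    ∫ ω, (∑' j, (notReturned z j).indicator (fun ω => Φ (shift j ω)) ω) ∂(lawFrom P x)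
      = ∫ y, (∫ ω, Φ ω ∂(lawFrom P y)) ∂(occupation P z x) := by
  have hI : Integrable Φ ((occupation P z x).bind (lawKernel P)) := by
    refine ⟨hΦ.aestronglyMeasurable, ?_⟩
    rw [HasFiniteIntegral, Measure.lintegral_bind (lawKernel P).measurable.aemeasurable
      hΦ.enorm.aemeasurable]
    exact hint
  have hI' := hI
  rw [← sum_map_shift_eq] at hI'
  have h1 : ∫ ω, Φ ω ∂((occupation P z x).bind (lawKernel P))
      = ∫ y, (∫ ω, Φ ω ∂(lawFrom P y)) ∂(occupation P z x) := by
    have hI2 := hI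
    rw [Measure.comp_eq_comp_const_apply] at hI2 ⊢
    rw [Kernel.integral_comp hI2]
    rfl
  rw [← h1, ← sum_map_shift_eq, integral_sum_measure hI', integral_tsum]
  · refine tsum_congr fun j => ?_
    rw [integral_indicator (measurableSet_notReturned z j),
      integral_map (measurable_shift j).aemeasurable hΦ.aestronglyMeasurable]
  · exact fun j => ((hΦ.comp (measurable_shift j)).indicator
      (measurableSet_notReturned z j)).aestronglyMeasurable
  · have h2 : ∀ j, ∫⁻ ω, ‖(notReturned z j).indicator (fun ω => Φ (shift j ω)) ω‖ₑ ∂(lawFrom P x)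
        = ∫⁻ ω in notReturned z j, ‖Φ (shift j ω)‖ₑ ∂(lawFrom P x) := by
      intro j
      rw [← lintegral_indicator (measurableSet_notReturned z j)]
      exact lintegral_congr fun ω => enorm_indicator_eq_indicator_enorm _ _
    rw [tsum_congr h2, tsum_shift_eq_lintegral_occupation P z x hΦ.enorm]
    exact hint.ne

section Moments

variable {P} {φ : S → ℝ} {z : S}

lemma integrable_cycleSum {x : S} (h1 : ∫⁻ y, ‖φ y‖ₑ ∂(occupation P z x) < ∞) :
    Integrable (cycleSum φ z) (lawFrom P x) := by
  refine ⟨(measurable_cycleSum φ z).aestronglyMeasurable, ?_⟩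
  refine (lintegral_mono fun ω => enorm_cycleSum_le φ z ω).trans_lt ?_
  rwa [lintegral_absCycleSum]

lemma lintegral_absCycleSum_sq_lt_top {x : S}
    (h2 : ∫⁻ y, ‖φ y‖ₑ * (∫⁻ y', ‖φ y'‖ₑ ∂(occupation P z y)) ∂(occupation P z x) < ∞) :
    ∫⁻ ω, absCycleSum φ z ω ^ 2 ∂(lawFrom P x) < ∞ := by
  refine (lintegral_absCycleSum_sq_le P φ z x).trans_lt ?_
  simp only [lintegral_absCycleSum]
  exact ENNReal.mul_lt_top (by simp) h2

lemma integrable_cycleSum_sq {x : S}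
    (h2 : ∫⁻ y, ‖φ y‖ₑ * (∫⁻ y', ‖φ y'‖ₑ ∂(occupation P z y)) ∂(occupation P z x) < ∞) :
    Integrable (fun ω => cycleSum φ z ω ^ 2) (lawFrom P x) := by
  refine ⟨((measurable_cycleSum φ z).pow_const 2).aestronglyMeasurable, ?_⟩
  refine (lintegral_mono fun ω => ?_).trans_lt (lintegral_absCycleSum_sq_lt_top h2)
  rw [enorm_pow]
  gcongr
  exact enorm_cycleSum_le φ z ω

lemma integral_cycleSum (hfin : ∀ z x, occupation P z x Set.univ < ∞) {x : S}
    (h1 : ∫⁻ y, ‖φ y‖ₑ ∂(occupation P z x) < ∞) :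
    ∫ ω, cycleSum φ z ω ∂(lawFrom P x) = ∫ y, φ y ∂(occupation P z x) := by
  have hc : ∀ y, (fun ω : ℕ → S => φ (ω 0)) =ᵐ[lawFrom P y] fun _ => φ y := fun y => by
    filter_upwards [ae_zero_eq P y] with ω hω
    rw [hω]
  have h := integral_tsum_shift P z x (Φ := fun ω => φ (ω 0)) (measurable_coord_comp φ 0) (by
    refine lt_of_eq_of_lt (lintegral_congr fun y => ?_) h1
    refine (lintegral_congr_ae ((hc y).fun_comp (fun t => ‖t‖ₑ))).trans ?_
    simp)
  have h3 : ∀ y, ∫ ω, φ (ω 0) ∂(lawFrom P y) = φ y := fun y => by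
    rw [integral_congr_ae (hc y)]; simp
  simp only [h3] at h
  rw [← h]
  refine integral_congr_ae ?_
  filter_upwards [ae_returnTime_lt_top hfin z x] with ω hω
  rw [tsum_notReturned_indicator hω]
  rfl

lemma enorm_integral_cycleSum_le (φ : S → ℝ) (z x : S) :
    ‖∫ ω, cycleSum φ z ω ∂(lawFrom P x)‖ₑ ≤ ∫⁻ y, ‖φ y‖ₑ ∂(occupation P z x) := by
  refine (enorm_integral_le_lintegral_enorm _).trans ?_
  rw [← lintegral_absCycleSum]
  exact lintegral_mono fun ω => enorm_cycleSum_le φ z ω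

lemma enorm_le_lintegral_occupation (φ : S → ℝ) (z x : S) :
    ‖φ x‖ₑ ≤ ∫⁻ y, ‖φ y‖ₑ ∂(occupation P z x) := by
  rw [lintegral_occupation]
  refine le_trans ?_ (ENNReal.le_tsum 0)
  rw [tabooExp_zero]

/-- After the pathwise expansion `sq_sum_range_eq`, the Markov property at time `j` replaces the
tail of the cycle by its expectation from `X_j`. For centered `φ` this expectation is `g_z(X_j)`. -/
lemma integral_cycleSum_sq (hfin : ∀ z x, occupation P z x Set.univ < ∞) {x : S}
    (h1 : ∀ x, ∫⁻ y, ‖φ y‖ₑ ∂(occupation P z x) < ∞)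
    (h2 : ∫⁻ y, ‖φ y‖ₑ * (∫⁻ y', ‖φ y'‖ₑ ∂(occupation P z y)) ∂(occupation P z x) < ∞) :
    ∫ ω, cycleSum φ z ω ^ 2 ∂(lawFrom P x)
      = ∫ y, φ y * (2 * (∫ ω, cycleSum φ z ω ∂(lawFrom P y)) - φ y) ∂(occupation P z x) := by
  have hm : Measurable fun ω : ℕ → S => φ (ω 0) * (2 * cycleSum φ z ω - φ (ω 0)) :=
    (measurable_coord_comp φ 0).mul
      (((measurable_cycleSum φ z).const_mul 2).sub (measurable_coord_comp φ 0))
  have hc : ∀ y, (fun ω : ℕ → S => φ (ω 0) * (2 * cycleSum φ z ω - φ (ω 0)))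
      =ᵐ[lawFrom P y] fun ω => φ y * (2 * cycleSum φ z ω - φ y) := fun y => by
    filter_upwards [ae_zero_eq P y] with ω hω
    rw [hω]
  have hint : ∫⁻ y, (∫⁻ ω, ‖φ (ω 0) * (2 * cycleSum φ z ω - φ (ω 0))‖ₑ ∂(lawFrom P y))
      ∂(occupation P z x) < ∞ := by
    -- The `3` is `2 + 1`: the diagonal term is absorbed because `|φ y|` is the time-zero part of
    -- the expected absolute cycle sum from `y`.
    refine lt_of_le_of_lt (b := ∫⁻ y, 3 * (‖φ y‖ₑ * (∫⁻ y', ‖φ y'‖ₑ ∂(occupation P z y)))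
      ∂(occupation P z x)) (lintegral_mono fun y => ?_) ?_
    · refine (lintegral_congr_ae ((hc y).fun_comp (fun t => ‖t‖ₑ))).trans_le ?_
      calc ∫⁻ ω, ‖φ y * (2 * cycleSum φ z ω - φ y)‖ₑ ∂(lawFrom P y)
          ≤ ∫⁻ ω, ‖φ y‖ₑ * (2 * absCycleSum φ z ω + ‖φ y‖ₑ) ∂(lawFrom P y) := by
            refine lintegral_mono fun ω => ?_
            rw [enorm_mul]
            gcongr
            refine (enorm_sub_le).trans ?_
            rw [enorm_mul]
            gcongr
            · simp [Real.enorm_eq_ofReal]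
            · exact enorm_cycleSum_le φ z ω
        _ = ‖φ y‖ₑ * (2 * (∫⁻ y', ‖φ y'‖ₑ ∂(occupation P z y)) + ‖φ y‖ₑ) := by
            rw [lintegral_const_mul _ (((measurable_absCycleSum φ z).const_mul 2).add_const _),
              lintegral_add_right _ measurable_const, lintegral_const_mul _
              (measurable_absCycleSum φ z), lintegral_absCycleSum]
            simp
        _ ≤ ‖φ y‖ₑ * (2 * (∫⁻ y', ‖φ y'‖ₑ ∂(occupation P z y))
              + ∫⁻ y', ‖φ y'‖ₑ ∂(occupation P z y)) := by
            gcongr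
            exact enorm_le_lintegral_occupation φ z y
        _ = _ := by ring
    · rw [lintegral_const_mul _ .of_discrete]
      exact ENNReal.mul_lt_top (by simp) h2
  have h := integral_tsum_shift P z x hm hint
  have h3 : ∀ y, ∫ ω, φ (ω 0) * (2 * cycleSum φ z ω - φ (ω 0)) ∂(lawFrom P y)
      = φ y * (2 * (∫ ω, cycleSum φ z ω ∂(lawFrom P y)) - φ y) := fun y => by
    rw [integral_congr_ae (hc y), integral_const_mul, integral_sub
      ((integrable_cycleSum (h1 y)).const_mul 2) (integrable_const _), integral_const_mul]
    simp
  simp only [h3] at h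
  rw [← h]
  refine integral_congr_ae ?_
  filter_upwards [ae_returnTime_lt_top hfin z x] with ω hω
  rw [tsum_notReturned_indicator hω, cycleSum_eq, sq_sum_range_eq]
  refine Finset.sum_congr rfl fun j hj => ?_
  rw [cycleSum_eq, returnLen_shift hω (mem_notReturned_of_lt_returnLen (Finset.mem_range.1 hj))]
  simp only [shift, add_zero]

end Moments

end

/-! ### Regeneration: independence of the cycles and their common law -/

section

variable {S : Type*} [MeasurableSpace S]

/-- The path after its first return to `z`. -/
def cycleShift (z : S) (ω : ℕ → S) : ℕ → S := shift (returnLen z ω) ω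

/-- Functionals of the first cycle, i.e. of the path up to its return to `z`. -/
def IsCycleFunctional {E : Type*} (z : S) (C : (ℕ → S) → E) : Prop :=
  ∀ (n : ℕ) (ω ω' : ℕ → S), returnTime z ω = n → (∀ i ≤ n, ω i = ω' i) → C ω = C ω'

omit [MeasurableSpace S] in
lemma returnTime_eq_iff {z : S} {n : ℕ} {ω : ℕ → S} :
    returnTime z ω = n ↔ ω ∉ notReturned z n ∧ ∀ j < n, ω ∈ notReturned z j := by
  constructor
  · intro h
    refine ⟨fun h1 => ?_, fun j hj => ?_⟩
    · exact absurd h1 (by simp [notReturned, h])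
    · change (j : ℕ∞) < returnTime z ω
      rw [h]
      exact_mod_cast hj
  · rintro ⟨h1, h2⟩
    have h1' : returnTime z ω ≤ n := not_lt.1 h1
    refine le_antisymm h1' (not_lt.1 fun h3 => ?_)
    have hτ : returnTime z ω < ⊤ := h3.trans (ENat.natCast_lt_top n)
    have h4 : returnLen z ω < n := by
      rw [← ENat.natCast_toNat hτ.ne, Nat.cast_lt] at h3
      exact h3
    exact lt_irrefl _ ((mem_notReturned_iff_lt_returnLen hτ).1 (h2 _ h4))

omit [MeasurableSpace S] in
lemma apply_of_returnTime_eq {z : S} {n : ℕ} {ω : ℕ → S} (h : returnTime z ω = n) :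
    1 ≤ n ∧ ω n = z := by
  obtain ⟨h1, h2⟩ := returnTime_eq_iff.1 h
  rw [mem_notReturned] at h1
  push Not at h1
  obtain ⟨i, hi1, hin, hi⟩ := h1
  rcases hin.lt_or_eq with h3 | rfl
  · exact absurd hi (mem_notReturned.1 (h2 i h3) i hi1 le_rfl)
  · exact ⟨hi1, hi⟩

omit [MeasurableSpace S] in
lemma determinedAt_returnTime_eq (z : S) (n : ℕ) : DeterminedAt n {ω | returnTime z ω = n} := by
  intro ω ω' h hω
  rw [Set.mem_ofPred_eq, returnTime_eq_iff] at hω ⊢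
  refine ⟨fun h1 => hω.1 ?_, fun j hj => ?_⟩
  · exact determinedAt_notReturned z n ω' ω (fun i hi => (h i hi).symm) h1
  · exact determinedAt_notReturned z j ω ω' (fun i hi => h i (by omega)) (hω.2 j hj)

omit [MeasurableSpace S] in
lemma isCycleFunctional_returnLen (z : S) : IsCycleFunctional z (returnLen z) := by
  intro n ω ω' h h'
  rw [returnLen, returnLen, h, determinedAt_returnTime_eq z n ω ω' h' h]

omit [MeasurableSpace S] in
lemma isCycleFunctional_cycleSum (φ : S → ℝ) (z : S) : IsCycleFunctional z (cycleSum φ z) := by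
  intro n ω ω' h h'
  rw [cycleSum_eq, cycleSum_eq, ← isCycleFunctional_returnLen z n ω ω' h h']
  refine Finset.sum_congr rfl fun j hj => ?_
  rw [h' j]
  rw [returnLen, h, ENat.toNat_natCast, Finset.mem_range] at hj
  exact hj.le

variable [Countable S] [DiscreteMeasurableSpace S]

@[fun_prop]
lemma measurable_cycleShift (z : S) : Measurable (cycleShift z) := by
  have h1 : Measurable fun p : ℕ × (ℕ → S) => shift p.1 p.2 :=
    measurable_from_prod_countable_right fun n => measurable_shift n
  exact h1.comp ((measurable_returnLen z).prodMk measurable_id)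

variable (P : Kernel S S) [IsMarkovKernel P]

lemma chainLaw_eq_bind (ν : Measure S) [IsProbabilityMeasure ν] :
    chainLaw P ν = ν.bind (lawFrom P) := by
  have h := markov_map_shift P ν (n := 0) (G := Set.univ) (fun _ _ _ _ => Set.mem_univ _)
  have hs : shift (S := S) 0 = id := by
    ext ω k
    simp [shift]
  rwa [Measure.restrict_univ, hs, Measure.map_id, map_zero_chainLaw] at h

lemma ae_chainLaw_of_ae_lawFrom (ν : Measure S) [IsProbabilityMeasure ν] {p : (ℕ → S) → Prop}
    (hp : MeasurableSet {ω | p ω}) (h : ∀ x, ∀ᵐ ω ∂(lawFrom P x), p ω) :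
    ∀ᵐ ω ∂(chainLaw P ν), p ω := by
  rw [ae_iff, chainLaw_eq_bind, Measure.bind_apply (.of_compl (by simpa [Set.compl_def] using hp))
    (measurable_lawFrom P).aemeasurable]
  simp only [ae_iff] at h
  simp [h]

lemma measurableSet_returnTime_lt_top (z : S) : MeasurableSet {ω | returnTime z ω < ⊤} := by
  have : {ω | returnTime z ω < ⊤} = ⋃ n : ℕ, {ω | returnTime z ω = n} := by
    ext ω
    simp only [Set.mem_ofPred_eq, Set.mem_iUnion]
    exact ⟨fun h => ⟨_, (ENat.natCast_toNat h.ne).symm⟩, by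
      rintro ⟨n, hn⟩; rw [hn]; exact ENat.natCast_lt_top n⟩
  rw [this]
  exact MeasurableSet.iUnion fun n => (determinedAt_returnTime_eq z n).measurableSet

section Regeneration

variable {P} {z : S}
variable {E : Type*} [MeasurableSpace E] {C : (ℕ → S) → E}

/-- Strong Markov property at the return time: the first cycle is independent of the path after
it, which has the law `P_z`. -/
lemma strong_markov (ν : Measure S) [IsProbabilityMeasure ν]
    (hτ : ∀ᵐ ω ∂(chainLaw P ν), returnTime z ω < ⊤) (hC : IsCycleFunctional z C)
    {A : Set E} {B : Set (ℕ → S)} (hB : MeasurableSet B) :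
    chainLaw P ν (C ⁻¹' A ∩ cycleShift z ⁻¹' B) = chainLaw P ν (C ⁻¹' A) * lawFrom P z B := by
  -- On `{τ(z) = n}` the first cycle is determined by time `n` and the present state is `z`, so the
  -- Markov property at the fixed time `n` applies.
  set G : ℕ → Set (ℕ → S) := fun n => {ω | returnTime z ω = n} ∩ C ⁻¹' A with hG
  have hGd : ∀ n, DeterminedAt n (G n) := fun n ω ω' h hω =>
    ⟨determinedAt_returnTime_eq z n ω ω' h hω.1, by
      have := hC n ω ω' hω.1 h
      rw [Set.mem_preimage, ← this]; exact hω.2⟩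
  have hdec : ∀ D : Set (ℕ → S), MeasurableSet D →
      chainLaw P ν (C ⁻¹' A ∩ D) = ∑' n, chainLaw P ν (G n ∩ D) := by
    intro D hD
    rw [← measure_iUnion]
    · refine measure_congr ?_
      filter_upwards [hτ] with ω hω
      refine propext ⟨fun h => Set.mem_iUnion.2 ⟨returnLen z ω, ⟨?_, h.1⟩, h.2⟩, fun h => ?_⟩
      · exact (ENat.natCast_toNat hω.ne).symm
      · obtain ⟨n, h1, h2⟩ := Set.mem_iUnion.1 h
        exact ⟨h1.2, h2⟩
    · intro a b hab
      refine Set.disjoint_left.2 fun ω h1 h2 => hab ?_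
      have : (a : ℕ∞) = b := h1.1.1.symm.trans h2.1.1
      exact_mod_cast this
    · exact fun n => (hGd n).measurableSet.inter hD
  have h1 := hdec Set.univ .univ
  simp only [Set.inter_univ] at h1
  rw [hdec _ (measurable_cycleShift z hB), h1, ← ENNReal.tsum_mul_right]
  refine tsum_congr fun n => ?_
  rw [← markov_property P ν (hGd n) (fun ω hω => (apply_of_returnTime_eq hω.1).2) hB]
  congr 1
  ext ω
  simp only [Set.mem_inter_iff, Set.mem_preimage, and_congr_right_iff]
  intro hω
  have : returnLen z ω = n := by rw [returnLen, hω.1, ENat.toNat_natCast]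
  rw [cycleShift, this]

variable (hτ : ∀ x, ∀ᵐ ω ∂(lawFrom P x), returnTime z ω < ⊤)
include hτ

lemma map_cycleShift (ν : Measure S) [IsProbabilityMeasure ν] :
    (chainLaw P ν).map (cycleShift z) = lawFrom P z := by
  have hν := ae_chainLaw_of_ae_lawFrom P ν (measurableSet_returnTime_lt_top z) hτ
  ext B hB
  have h := strong_markov ν hν (C := fun _ => ()) (fun _ _ _ _ _ => rfl)
    (A := Set.univ) hB
  rw [Measure.map_apply (measurable_cycleShift z) hB]
  simpa using h

lemma map_iterate_cycleShift (ν : Measure S) [IsProbabilityMeasure ν] (k : ℕ) :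
    (chainLaw P ν).map ((cycleShift z)^[k + 1]) = lawFrom P z := by
  induction k with
  | zero => exact map_cycleShift hτ ν
  | succ k ih =>
    rw [Function.iterate_succ', ← Measure.map_map (measurable_cycleShift z)
      ((measurable_cycleShift z).iterate _), ih, map_cycleShift hτ]

lemma ae_forall_returnTime_lt_top (ν : Measure S) [IsProbabilityMeasure ν] :
    ∀ᵐ ω ∂(chainLaw P ν), ∀ k, returnTime z ((cycleShift z)^[k] ω) < ⊤ := by
  rw [ae_all_iff]
  intro k
  rcases k with _ | k
  · exact ae_chainLaw_of_ae_lawFrom P ν (measurableSet_returnTime_lt_top z) hτ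
  · have h := hτ z
    rw [← map_iterate_cycleShift hτ ν k] at h
    exact ae_of_ae_map ((measurable_cycleShift z).iterate _).aemeasurable h

/-- Induction on the number of cycles, over all initial laws: after the first cycle has been split
off, the remaining path starts from `z` instead of `ν`. -/
lemma measure_cycles_eq_prod (hC : IsCycleFunctional z C) (hCm : Measurable C) (n : ℕ)
    (ν : Measure S) [IsProbabilityMeasure ν] {A : ℕ → Set E} (hA : ∀ i, MeasurableSet (A i)) :
    chainLaw P ν {ω | ∀ i < n, C ((cycleShift z)^[i] ω) ∈ A i}
      = ∏ i ∈ Finset.range n, chainLaw P ν {ω | C ((cycleShift z)^[i] ω) ∈ A i} := by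
  have hm : ∀ (i : ℕ) {B : Set E}, MeasurableSet B →
      MeasurableSet {ω | C ((cycleShift z)^[i] ω) ∈ B} := fun i B hB =>
    (hCm.comp ((measurable_cycleShift z).iterate i)) hB
  induction n generalizing ν A with
  | zero => simp
  | succ n ih =>
    have hν := ae_chainLaw_of_ae_lawFrom P ν (measurableSet_returnTime_lt_top z) hτ
    have h1 : {ω | ∀ i < n + 1, C ((cycleShift z)^[i] ω) ∈ A i}
        = C ⁻¹' (A 0) ∩ cycleShift z ⁻¹' {ω | ∀ i < n, C ((cycleShift z)^[i] ω) ∈ A (i + 1)} := by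
      ext ω
      simp only [Set.mem_ofPred_eq, Set.mem_inter_iff, Set.mem_preimage,
        ← Function.iterate_succ_apply]
      constructor
      · exact fun h => ⟨h 0 (by omega), fun i hi => h (i + 1) (by omega)⟩
      · rintro ⟨h0, h⟩ i hi
        rcases i with _ | i
        · exact h0
        · exact h i (by omega)
    have h2 : MeasurableSet {ω | ∀ i < n, C ((cycleShift z)^[i] ω) ∈ A (i + 1)} := by
      have : {ω | ∀ i < n, C ((cycleShift z)^[i] ω) ∈ A (i + 1)}
          = ⋂ i ∈ Finset.range n, {ω | C ((cycleShift z)^[i] ω) ∈ A (i + 1)} := by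
        ext ω; simp
      rw [this]
      exact Finset.measurableSet_biInter _ fun i _ => hm i (hA _)
    rw [h1, strong_markov ν hν hC h2, ih (Measure.dirac z) (fun i => hA (i + 1)),
      Finset.prod_range_succ', mul_comm]
    congr 1
    refine Finset.prod_congr rfl fun i _ => ?_
    have h3 : {ω | C ((cycleShift z)^[i + 1] ω) ∈ A (i + 1)}
        = cycleShift z ⁻¹' {ω | C ((cycleShift z)^[i] ω) ∈ A (i + 1)} := by
      ext ω; simp only [Set.mem_ofPred_eq, Set.mem_preimage, Function.iterate_succ_apply]
    rw [h3, ← Measure.map_apply (measurable_cycleShift z) (hm i (hA _)), map_cycleShift hτ ν]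

/-- Functionals of successive cycles are independent. -/
lemma iIndepFun_cycles (hC : IsCycleFunctional z C) (hCm : Measurable C)
    (ν : Measure S) [IsProbabilityMeasure ν] :
    iIndepFun (fun (k : ℕ) ω => C ((cycleShift z)^[k] ω)) (chainLaw P ν) := by
  classical
  rw [iIndepFun_iff_measure_inter_preimage_eq_mul]
  intro s A hA
  -- Padding with `Set.univ` reduces an arbitrary finite set of cycles to an initial segment.
  set A' : ℕ → Set E := fun i => if i ∈ s then A i else Set.univ with hA'
  have hA'm : ∀ i, MeasurableSet (A' i) := fun i => by
    by_cases hi : i ∈ s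
    · simpa [hA', hi] using hA i hi
    · simp [hA', hi]
  have hsub : s ⊆ Finset.range (s.sup id + 1) := fun i hi =>
    Finset.mem_range.2 (Nat.lt_succ_of_le (Finset.le_sup (f := id) hi))
  have h := measure_cycles_eq_prod hτ hC hCm (s.sup id + 1) ν hA'm
  rw [← Finset.prod_subset hsub] at h
  · convert h using 1
    · congr 1
      ext ω
      simp only [Set.mem_iInter, Set.mem_preimage, Set.mem_ofPred_eq]
      constructor
      · intro h i _
        by_cases hi : i ∈ s
        · simpa [hA', hi] using h i hi
        · simp [hA', hi]
      · intro h i hi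
        have := h i (Finset.mem_range.1 (hsub hi))
        simpa [hA', hi] using this
    · refine Finset.prod_congr rfl fun i hi => ?_
      congr 1
      ext ω
      simp [hA', hi]
  · intro i _ hi
    simp [hA', hi]

/-- All cycles after the first one have the law of the first cycle under `P_z`. -/
lemma identDistrib_cycles (hCm : Measurable C) (ν : Measure S) [IsProbabilityMeasure ν] (k : ℕ) :
    IdentDistrib (fun ω => C ((cycleShift z)^[k + 1] ω)) C (chainLaw P ν) (lawFrom P z) where
  aemeasurable_fst := (hCm.comp ((measurable_cycleShift z).iterate _)).aemeasurable
  aemeasurable_snd := hCm.aemeasurable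
  map_eq := by
    rw [← map_iterate_cycleShift hτ ν k, Measure.map_map hCm ((measurable_cycleShift z).iterate _)]
    rfl

end Regeneration

section Path

omit [MeasurableSpace S] [Countable S] [DiscreteMeasurableSpace S]

lemma iterate_cycleShift_eq (z : S) (ω : ℕ → S) (k : ℕ) :
    (cycleShift z)^[k] ω = shift (∑ i ∈ Finset.range k, returnLen z ((cycleShift z)^[i] ω)) ω := by
  induction k with
  | zero => ext n; simp [shift]
  | succ k ih =>
    rw [Function.iterate_succ_apply', Finset.sum_range_succ]
    conv_lhs => rw [cycleShift, ih]
    ext n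
    simp only [shift, ← ih]
    congr 1
    ring

lemma sum_cycleSum_eq (φ : S → ℝ) (z : S) (ω : ℕ → S) (k : ℕ) :
    ∑ i ∈ Finset.range k, cycleSum φ z ((cycleShift z)^[i] ω)
      = ∑ j ∈ Finset.range (∑ i ∈ Finset.range k, returnLen z ((cycleShift z)^[i] ω)), φ (ω j) := by
  induction k with
  | zero => simp
  | succ k ih =>
    rw [Finset.sum_range_succ, ih, Finset.sum_range_succ, Finset.sum_range_add, cycleSum_eq]
    congr 1
    refine Finset.sum_congr rfl fun j _ => ?_
    conv_lhs => rw [iterate_cycleShift_eq]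
    rfl

/-- The additive functional differs from the sum over the completed and current cycles by at most
the absolute sum over the current cycle. -/
lemma abs_additiveFunctional_sub_le (φ : S → ℝ) (z : S) (ω : ℕ → S) {n k : ℕ}
    (h1 : ∑ i ∈ Finset.range k, returnLen z ((cycleShift z)^[i] ω) ≤ n)
    (h2 : n < ∑ i ∈ Finset.range (k + 1), returnLen z ((cycleShift z)^[i] ω)) :
    |additiveFunctional φ n ω - ∑ i ∈ Finset.range (k + 1), cycleSum φ z ((cycleShift z)^[i] ω)|
      ≤ cycleSum (fun x => |φ x|) z ((cycleShift z)^[k] ω) := by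
  rw [sum_cycleSum_eq, additiveFunctional, abs_sub_comm, ← Finset.sum_Ico_eq_sub _ h2.le]
  refine (Finset.abs_sum_le_sum_abs _ _).trans ?_
  have h3 := sum_cycleSum_eq (fun x => |φ x|) z ω (k + 1)
  rw [Finset.sum_range_succ, sum_cycleSum_eq] at h3
  have h4 : cycleSum (fun x => |φ x|) z ((cycleShift z)^[k] ω)
      = ∑ j ∈ Finset.Ico (∑ i ∈ Finset.range k, returnLen z ((cycleShift z)^[i] ω))
        (∑ i ∈ Finset.range (k + 1), returnLen z ((cycleShift z)^[i] ω)), |φ (ω j)| := by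
    rw [Finset.sum_Ico_eq_sub _ (h1.trans h2.le), ← h3]
    ring
  rw [h4]
  exact Finset.sum_le_sum_of_subset_of_nonneg (Finset.Ico_subset_Ico_left h1)
    fun _ _ _ => abs_nonneg _

end Path

end

/-! ### Predictable sums and pathwise renewal theory -/

section

open scoped Topology

variable {Ω : Type*} [mΩ : MeasurableSpace Ω] {μ : Measure Ω} [IsProbabilityMeasure μ]

/-- Orthogonality of predictable multiples of independent centered variables. -/
lemma integral_sum_predictable_sq (ℱ : ℕ → MeasurableSpace Ω) (hmono : Monotone ℱ)
    (hle : ∀ k, ℱ k ≤ mΩ) {Y ε : ℕ → Ω → ℝ} {v : ℝ}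
    (hε : ∀ k, Measurable[ℱ k] (ε k)) (hε1 : ∀ k ω, |ε k ω| ≤ 1)
    (hY : ∀ k, Measurable[ℱ (k + 1)] (Y k))
    (hind : ∀ k, Indep (ℱ k) (MeasurableSpace.comap (Y k) inferInstance) μ)
    (hL2 : ∀ k, MemLp (Y k) 2 μ) (h0 : ∀ k, ∫ ω, Y k ω ∂μ = 0)
    (hv : ∀ k, ∫ ω, Y k ω ^ 2 ∂μ = v) (n : ℕ) :
    MemLp (fun ω => ∑ i ∈ Finset.range n, ε i ω * Y i ω) 2 μ ∧
    ∫ ω, (∑ i ∈ Finset.range n, ε i ω * Y i ω) ^ 2 ∂μ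
      = v * ∫ ω, ∑ i ∈ Finset.range n, ε i ω ^ 2 ∂μ := by
  have hYm : ∀ k, Measurable (Y k) := fun k => (hY k).mono (hle _) le_rfl
  have hεm : ∀ k, Measurable (ε k) := fun k => (hε k).mono (hle _) le_rfl
  have hterm : ∀ i, MemLp (fun ω => ε i ω * Y i ω) 2 μ := fun i =>
    (hL2 i).mono ((hεm i).mul (hYm i)).aestronglyMeasurable (.of_forall fun ω => by
      rw [norm_mul]
      exact mul_le_of_le_one_left (norm_nonneg _) (hε1 i ω))
  have hsum : ∀ n, MemLp (fun ω => ∑ i ∈ Finset.range n, ε i ω * Y i ω) 2 μ := fun n =>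
    memLp_finsetSum _ fun i _ => hterm i
  have hε2 : ∀ i, Integrable (fun ω => ε i ω ^ 2) μ := fun i =>
    Integrable.of_bound ((hεm i).pow_const 2).aestronglyMeasurable 1 (.of_forall fun ω => by
      rw [norm_pow]
      exact pow_le_one₀ (norm_nonneg _) (hε1 i ω))
  refine ⟨hsum n, ?_⟩
  induction n with
  | zero => simp
  | succ n ih =>
    set A : Ω → ℝ := fun ω => ∑ i ∈ Finset.range n, ε i ω * Y i ω with hA
    have hAm : Measurable[ℱ n] A := by
      refine Finset.measurable_fun_sum _ fun i hi => ?_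
      have hi' := Finset.mem_range.1 hi
      exact ((hε i).mono (hmono hi'.le) le_rfl).mul ((hY i).mono (hmono hi') le_rfl)
    have hind' : ∀ {X : Ω → ℝ}, Measurable[ℱ n] X → ∀ {g : ℝ → ℝ}, Measurable g →
        IndepFun X (fun ω => g (Y n ω)) μ := by
      intro X hX g hg
      have : IndepFun X (Y n) μ := by
        rw [IndepFun_iff_Indep]
        exact indep_of_indep_of_le_left (hind n) hX.comap_le
      exact this.comp measurable_id hg
    have hAε : Integrable (fun ω => A ω * ε n ω) μ :=
      ((hsum n).integrable (by norm_num)).mul_bdd (c := 1) (hεm n).aestronglyMeasurable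
        (.of_forall fun ω => hε1 n ω)
    have hI2 : Integrable (fun ω => A ω * ε n ω * Y n ω) μ := by
      have := (hsum n).integrable_mul (hterm n)
      refine this.congr (.of_forall fun ω => ?_)
      simp only [Pi.mul_apply, hA]
      ring
    -- Both `A` and `ε n` are `ℱ n`-measurable, hence independent of the centered `Y n`.
    have hcross : ∫ ω, A ω * ε n ω * Y n ω ∂μ = 0 := by
      have h := (hind' (hAm.mul (hε n)) measurable_id).integral_mul_eq_mul_integral
        hAε.aestronglyMeasurable (hYm n).aestronglyMeasurable
      have h' : ∫ ω, A ω * ε n ω * Y n ω ∂μ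
          = (∫ ω, A ω * ε n ω ∂μ) * ∫ ω, Y n ω ∂μ := h
      rw [h', h0, mul_zero]
    have hsq : ∫ ω, ε n ω ^ 2 * Y n ω ^ 2 ∂μ = (∫ ω, ε n ω ^ 2 ∂μ) * v := by
      have h := (hind' ((hε n).pow_const 2)
        (measurable_id.pow_const 2)).integral_mul_eq_mul_integral
        (hε2 n).aestronglyMeasurable ((hYm n).pow_const 2).aestronglyMeasurable
      rw [← hv n]
      exact h
    have hexp : ∀ ω, (∑ i ∈ Finset.range (n + 1), ε i ω * Y i ω) ^ 2
        = A ω ^ 2 + 2 * (A ω * ε n ω * Y n ω) + ε n ω ^ 2 * Y n ω ^ 2 := fun ω => by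
      rw [Finset.sum_range_succ, hA]; ring
    have hI3 : Integrable (fun ω => ε n ω ^ 2 * Y n ω ^ 2) μ :=
      (hterm n).integrable_sq.congr (.of_forall fun ω => mul_pow _ _ _)
    have hA2 : Integrable (fun ω => A ω ^ 2) μ := (hsum n).integrable_sq
    have hA3 : Integrable (fun ω => A ω ^ 2 + 2 * (A ω * ε n ω * Y n ω)) μ :=
      hA2.add (hI2.const_mul 2)
    simp only [hexp]
    rw [integral_add hA3 hI3, integral_add hA2 (hI2.const_mul 2), integral_const_mul, hcross, hsq,
      ih]
    simp only [Finset.sum_range_succ]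
    rw [integral_add (integrable_finsetSum _ fun i _ => hε2 i) (hε2 n)]
    ring

lemma tendsto_natCast_succ_div : Tendsto (fun n : ℕ => ((n + 1 : ℕ) : ℝ) / n) atTop (𝓝 1) := by
  have := (tendsto_natCast_div_add_atTop (1 : ℝ)).inv₀ one_ne_zero
  simpa using this

/-- If the averages of `a` converge then `a n / n → 0`. -/
lemma tendsto_div_of_tendsto_average {a : ℕ → ℝ} {c : ℝ}
    (h : Tendsto (fun n : ℕ => (∑ i ∈ Finset.range n, a i) / n) atTop (𝓝 c)) :
    Tendsto (fun n : ℕ => a n / n) atTop (𝓝 0) := by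
  have h2 := ((h.comp (tendsto_add_atTop_nat 1)).mul tendsto_natCast_succ_div).sub h
  rw [mul_one, sub_self] at h2
  refine h2.congr' ?_
  filter_upwards [eventually_gt_atTop 0] with n hn
  have hn' : (n : ℝ) ≠ 0 := by exact_mod_cast hn.ne'
  have hn1 : ((n + 1 : ℕ) : ℝ) ≠ 0 := by positivity
  simp only [Function.comp_apply]
  rw [div_mul_div_cancel₀ hn1, Finset.sum_range_succ, ← sub_div]
  congr 1
  ring

lemma tendsto_shift_div {a : ℕ → ℝ} {c : ℝ}
    (h : Tendsto (fun n : ℕ => a (n + 1) / n) atTop (𝓝 c)) :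
    Tendsto (fun n : ℕ => a n / n) atTop (𝓝 c) := by
  rw [← tendsto_add_atTop_iff_nat 1]
  have h2 := h.mul (tendsto_natCast_div_add_atTop (1 : ℝ))
  rw [mul_one] at h2
  refine h2.congr' ?_
  filter_upwards [eventually_gt_atTop 0] with n hn
  have hn' : (n : ℝ) ≠ 0 := by exact_mod_cast hn.ne'
  rw [div_mul_div_cancel₀ hn']
  push_cast
  rfl

section Renewal

/-- The number of renewals up to time `n`. -/
def renewalCount (T : ℕ → ℕ) (n : ℕ) : ℕ := Nat.findGreatest (fun k => T k ≤ n) n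

variable {T : ℕ → ℕ} (hT0 : T 0 = 0) (hT : StrictMono T)
include hT0

lemma apply_renewalCount_le (n : ℕ) : T (renewalCount T n) ≤ n :=
  Nat.findGreatest_spec (P := fun k => T k ≤ n) (Nat.zero_le n) (by rw [hT0]; exact Nat.zero_le n)

include hT

lemma lt_apply_renewalCount_succ (n : ℕ) : n < T (renewalCount T n + 1) := by
  by_contra h
  rw [not_lt] at h
  rcases Nat.lt_or_ge n (renewalCount T n + 1) with h1 | h1
  -- A strictly increasing `T` satisfies `k ≤ T k`, so the search bound `n` in `renewalCount` loses
  -- no renewal.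
  · have := hT.id_le (renewalCount T n + 1)
    simp only [id] at this
    omega
  · exact Nat.findGreatest_is_greatest (P := fun k => T k ≤ n) (Nat.lt_succ_self _) h1 h

lemma le_renewalCount_iff (n k : ℕ) : k ≤ renewalCount T n ↔ T k ≤ n := by
  constructor
  · exact fun h => (hT.monotone h).trans (apply_renewalCount_le hT0 n)
  · intro h
    by_contra h1
    have := hT.monotone (Nat.succ_le_of_lt (not_le.1 h1))
    have h2 := lt_apply_renewalCount_succ hT0 hT n
    simp only [Nat.succ_eq_add_one] at this
    omega

omit hT0 hT in
lemma renewalCount_le (n : ℕ) : renewalCount T n ≤ n := Nat.findGreatest_le n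

lemma tendsto_renewalCount : Tendsto (renewalCount T) atTop atTop :=
  tendsto_atTop.2 fun k => by
    filter_upwards [eventually_ge_atTop (T k)] with n hn
    exact (le_renewalCount_iff hT0 hT n k).2 hn

/-- Elementary renewal theorem, pathwise. -/
lemma tendsto_renewalCount_div {c : ℝ} (hc : c ≠ 0)
    (h : Tendsto (fun k : ℕ => (T k : ℝ) / k) atTop (𝓝 c)) :
    Tendsto (fun n : ℕ => (renewalCount T n : ℝ) / n) atTop (𝓝 c⁻¹) := by
  have hN := tendsto_renewalCount hT0 hT
  have h1 : Tendsto (fun k : ℕ => (T (k + 1) : ℝ) / k) atTop (𝓝 c) := by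
    have h2 := (h.comp (tendsto_add_atTop_nat 1)).mul tendsto_natCast_succ_div
    rw [mul_one] at h2
    refine h2.congr fun n => ?_
    have hn1 : ((n + 1 : ℕ) : ℝ) ≠ 0 := by positivity
    simp only [Function.comp_apply]
    rw [div_mul_div_cancel₀ hn1]
  have h3 : Tendsto (fun n : ℕ => (n : ℝ) / renewalCount T n) atTop (𝓝 c) := by
    refine tendsto_of_tendsto_of_tendsto_of_le_of_le (h.comp hN) (h1.comp hN)
      (fun n => ?_) (fun n => ?_)
    · simp only [Function.comp_apply]
      gcongr
      exact apply_renewalCount_le hT0 n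
    · simp only [Function.comp_apply]
      gcongr
      exact (lt_apply_renewalCount_succ hT0 hT n).le
  simpa using h3.inv₀ hc

-- The difference of the indicators is `±1` exactly between `N` and `m`, so its squares count that
-- gap.
omit hT0 hT in
lemma sum_sq_sub_indicator {N m n : ℕ} (hN : N ≤ n) (hm : m ≤ n) :
    ∑ i ∈ Finset.range n, ((if i < N then (1 : ℝ) else 0) - (if i < m then 1 else 0)) ^ 2
      = |(N : ℝ) - m| := by
  have hcount : ∀ k ≤ n, ∑ i ∈ Finset.range n, (if i < k then (1 : ℝ) else 0) = k := by
    intro k hk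
    rw [Finset.sum_ite, Finset.sum_const_zero, add_zero, Finset.sum_const, nsmul_one]
    congr 1
    rw [show (Finset.range n).filter (· < k) = Finset.range k by ext i; simp; omega,
      Finset.card_range]
  have h1 : ∀ i, ((if i < N then (1 : ℝ) else 0) - (if i < m then 1 else 0)) ^ 2
      = (if i < N then (1 : ℝ) else 0) + (if i < m then (1 : ℝ) else 0)
        - 2 * (if i < min N m then (1 : ℝ) else 0) := by
    intro i
    by_cases h1 : i < N <;> by_cases h2 : i < m <;> simp [h1, h2]
    norm_num
  simp only [h1]
  rw [Finset.sum_sub_distrib, Finset.sum_add_distrib, ← Finset.mul_sum, hcount _ hN, hcount _ hm,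
    hcount _ (min_le_of_left_le hN)]
  rcases le_total N m with h | h
  · have h' : (N : ℝ) ≤ m := by exact_mod_cast h
    rw [min_eq_left h, abs_of_nonpos (by linarith)]; ring
  · have h' : (m : ℝ) ≤ N := by exact_mod_cast h
    rw [min_eq_right h, abs_of_nonneg (by linarith)]; ring

end Renewal

end

/-! ### The central limit theorem for a random number of cycles -/

section

open scoped Topology

variable {Ω : Type*} [mΩ : MeasurableSpace Ω] {μ : Measure Ω} [IsProbabilityMeasure μ]

lemma tendstoInMeasure_of_tendsto_integral_sq {Q : ℕ → Ω → ℝ} (hQ : ∀ n, MemLp (Q n) 2 μ)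
    (h : Tendsto (fun n => ∫ ω, Q n ω ^ 2 ∂μ) atTop (𝓝 0)) :
    TendstoInMeasure μ Q atTop (fun _ => 0) := by
  rw [tendstoInMeasure_iff_measureReal_norm]
  intro δ hδ
  have h1 := h.div_const (δ ^ 2)
  rw [zero_div] at h1
  refine squeeze_zero (fun n => measureReal_nonneg) (fun n => ?_) h1
  rw [le_div_iff₀ (by positivity), mul_comm]
  refine le_trans ?_ (mul_meas_ge_le_integral_of_nonneg (.of_forall fun ω => sq_nonneg _)
    (hQ n).integrable_sq (δ ^ 2))
  refine mul_le_mul_of_nonneg_left (measureReal_mono fun ω hω => ?_) (sq_nonneg δ)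
  rw [Set.mem_ofPred_eq, sub_zero, Real.norm_eq_abs] at hω
  rw [Set.mem_ofPred_eq, ← sq_abs (Q n ω)]
  gcongr

/-- Central limit theorem for normalized partial sums with a deterministic number of terms
asymptotic to `c n`. -/
lemma tendstoInDistribution_sum_div_sqrt {Y : ℕ → Ω → ℝ} (hind : iIndepFun Y μ)
    (hident : ∀ i, IdentDistrib (Y i) (Y 0) μ μ) (hY2 : MemLp (Y 0) 2 μ)
    (hY0 : ∫ ω, Y 0 ω ∂μ = 0) {m : ℕ → ℕ} {c : ℝ} (hm : Tendsto m atTop atTop)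
    (hmn : Tendsto (fun n : ℕ => (m n : ℝ) / n) atTop (𝓝 c)) :
    TendstoInDistribution (fun (n : ℕ) ω => (∑ i ∈ Finset.range (m n), Y i ω) / √(n : ℝ)) atTop
      (fun x : ℝ => √((∫ ω, Y 0 ω ^ 2 ∂μ) * c) * x) (fun _ => μ) (gaussianReal 0 1) := by
  have hvar : Var[Y 0; μ] = ∫ ω, Y 0 ω ^ 2 ∂μ := by
    rw [variance_eq_integral hY2.aemeasurable, hY0]
    simp
  set v := ∫ ω, Y 0 ω ^ 2 ∂μ with hv
  have hv0 : 0 ≤ v := integral_nonneg fun ω => sq_nonneg _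
  have hlaw : HasLaw (fun x : ℝ => √v * x) (gaussianReal 0 Var[Y 0; μ].toNNReal)
      (gaussianReal 0 1) := by
    refine ⟨by fun_prop, ?_⟩
    rw [gaussianReal_map_const_mul, hvar, mul_zero, mul_one]
    congr 1
    ext
    simp [Real.sq_sqrt hv0, hv0]
  have h1 := tendstoInDistribution_inv_sqrt_mul_sum_sub hlaw hY2 hind hident
  have h2 : TendstoInDistribution (fun (n : ℕ) ω => (√(m n : ℝ))⁻¹ *
      (∑ i ∈ Finset.range (m n), Y i ω - (m n : ℝ) * ∫ ω, Y 0 ω ∂μ)) atTop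
      (fun x : ℝ => √v * x) (fun _ => μ) (gaussianReal 0 1) :=
    ⟨fun n => h1.forall_aemeasurable (m n), h1.aemeasurable_limit, h1.tendsto.comp hm⟩
  have h3 : TendstoInMeasure μ (fun (n : ℕ) (_ : Ω) => √((m n : ℝ) / n)) atTop
      (fun _ => √c) :=
    tendstoInMeasure_of_tendsto_ae (fun _ => by fun_prop)
      (.of_forall fun _ => (Real.continuous_sqrt.tendsto c).comp hmn)
  -- Slutsky: the normalization is changed from `√(m n)` to `√n` by a deterministic factor tending
  -- to `√c`.
  have h4 := h2.continuous_comp_prodMk_of_tendstoInMeasure_const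
    (g := fun p : ℝ × ℝ => p.2 * p.1) (by fun_prop) h3 (fun _ => by fun_prop)
  refine h4.congr (fun n => .of_forall fun ω => ?_) (.of_forall fun x => ?_)
  · simp only [hY0, mul_zero, sub_zero]
    rcases Nat.eq_zero_or_pos (m n) with h0 | h0
    · simp [h0]
    · have : √(m n : ℝ) ≠ 0 := by positivity
      rw [Real.sqrt_div (Nat.cast_nonneg _)]
      field_simp
  · simp only
    rw [Real.sqrt_mul hv0]
    ring

/-- Central limit theorem for processes with regenerative increments: `Y`, `L` and `W` are the
increments, the lengths and the fluctuation bounds of the successive cycles. -/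
theorem tendstoInDistribution_of_renewal {Y W : ℕ → Ω → ℝ} {L : ℕ → Ω → ℕ} {X : ℕ → Ω → ℝ}
    (hYm : ∀ k, Measurable (Y k)) (hLm : ∀ k, Measurable (L k))
    (hWm : ∀ k, Measurable (W k))
    (hXm : ∀ k, Measurable (X k))
    (hind : iIndepFun (fun k ω => (Y k ω, L k ω, W k ω)) μ)
    (hident : ∀ k, IdentDistrib (fun ω => (Y (k + 1) ω, L (k + 1) ω, W (k + 1) ω))
      (fun ω => (Y 1 ω, L 1 ω, W 1 ω)) μ μ)
    (hL : ∀ᵐ ω ∂μ, ∀ k, 1 ≤ L k ω) (hL1 : Integrable (fun ω => (L 1 ω : ℝ)) μ)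
    (hY2 : MemLp (Y 1) 2 μ) (hY0 : ∫ ω, Y 1 ω ∂μ = 0)
    (hW : Integrable (fun ω => W 1 ω ^ 2) μ)
    (hX : ∀ᵐ ω ∂μ, ∀ n k, ∑ i ∈ Finset.range k, L i ω ≤ n → n < ∑ i ∈ Finset.range (k + 1), L i ω →
      |X n ω - ∑ i ∈ Finset.range (k + 1), Y i ω| ≤ W k ω) :
    TendstoInDistribution (fun (n : ℕ) ω => X n ω / √(n : ℝ)) atTop
      (fun x : ℝ => √((∫ ω, Y 1 ω ^ 2 ∂μ) / ∫ ω, (L 1 ω : ℝ) ∂μ) * x) (fun _ => μ)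
      (gaussianReal 0 1) := by
  set ℓ := ∫ ω, (L 1 ω : ℝ) ∂μ with hℓ
  set v := ∫ ω, Y 1 ω ^ 2 ∂μ with hv
  have hℓ1 : 1 ≤ ℓ := by
    have : ∫ _ : Ω, (1 : ℝ) ∂μ ≤ ℓ := by
      refine integral_mono_ae (integrable_const _) hL1 ?_
      filter_upwards [hL] with ω hω
      exact_mod_cast hω 1
    simpa using this
  have hℓ0 : 0 < ℓ := zero_lt_one.trans_le hℓ1
  -- renewal times
  set T : Ω → ℕ → ℕ := fun ω k => ∑ i ∈ Finset.range k, L i ω with hT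
  have hTm : ∀ k, Measurable fun ω => T ω k := fun k =>
    Finset.measurable_fun_sum _ fun i _ => hLm i
  have hT0 : ∀ ω, T ω 0 = 0 := fun ω => by simp [hT]
  have hTmono : ∀ᵐ ω ∂μ, StrictMono (T ω) := by
    filter_upwards [hL] with ω hω
    refine strictMono_nat_of_lt_succ fun k => ?_
    simp only [hT, Finset.sum_range_succ]
    have := hω k
    omega
  -- The law of large numbers runs over the indices `i + 1` because cycle `0` depends on the initial
  -- distribution and may have another law.
  have hpair : ∀ {g : ℝ × ℕ × ℝ → ℝ}, Measurable g →
      Integrable (fun ω => g (Y 1 ω, L 1 ω, W 1 ω)) μ →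
      ∀ᵐ ω ∂μ, Tendsto (fun n : ℕ => (∑ i ∈ Finset.range n,
        g (Y (i + 1) ω, L (i + 1) ω, W (i + 1) ω)) / n) atTop
        (𝓝 (∫ ω, g (Y 1 ω, L 1 ω, W 1 ω) ∂μ)) := by
    intro g hg hint
    refine strong_law_ae_real (fun i ω => g (Y (i + 1) ω, L (i + 1) ω, W (i + 1) ω)) hint
      (fun i j hij => ?_) (fun i => (hident i).comp hg)
    exact (hind.indepFun (show i + 1 ≠ j + 1 by omega)).comp hg hg
  have hTlim : ∀ᵐ ω ∂μ, Tendsto (fun k : ℕ => (T ω k : ℝ) / k) atTop (𝓝 ℓ) := by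
    have hg : Measurable fun p : ℝ × ℕ × ℝ => (p.2.1 : ℝ) := by fun_prop
    filter_upwards [hpair hg hL1] with ω hω
    refine tendsto_shift_div (a := fun k => (T ω k : ℝ)) ?_
    have h1 := hω.add (tendsto_const_div_atTop_nhds_zero_nat (L 0 ω : ℝ))
    rw [add_zero] at h1
    refine h1.congr fun n => ?_
    simp only [hT]
    rw [Finset.sum_range_succ', ← add_div]
    push_cast
    rfl
  have hWlim : ∀ᵐ ω ∂μ, Tendsto (fun k : ℕ => W k ω ^ 2 / k) atTop (𝓝 0) := by
    have hg : Measurable fun p : ℝ × ℕ × ℝ => p.2.2 ^ 2 := by fun_prop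
    filter_upwards [hpair hg hW] with ω hω
    exact tendsto_shift_div (a := fun k => W k ω ^ 2) (tendsto_div_of_tendsto_average hω)
  have hNlim : ∀ᵐ ω ∂μ, Tendsto (fun n : ℕ => (renewalCount (T ω) n : ℝ) / n) atTop (𝓝 ℓ⁻¹) := by
    filter_upwards [hTmono, hTlim] with ω h1 h2
    exact tendsto_renewalCount_div (hT0 ω) h1 hℓ0.ne' h2
  -- the deterministic approximation of the number of renewals
  set m : ℕ → ℕ := fun n => ⌊ℓ⁻¹ * n⌋₊ with hm
  have hmlim : Tendsto (fun n : ℕ => (m n : ℝ) / n) atTop (𝓝 ℓ⁻¹) :=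
    (tendsto_nat_floor_mul_div_atTop (inv_nonneg.2 hℓ0.le)).comp tendsto_natCast_atTop_atTop
  have hmtop : Tendsto m atTop atTop :=
    tendsto_nat_floor_atTop.comp
      (tendsto_natCast_atTop_atTop.const_mul_atTop (inv_pos.2 hℓ0))
  have hmle : ∀ n, m n ≤ n := fun n => by
    refine Nat.floor_le_of_le ?_
    exact mul_le_of_le_one_left (Nat.cast_nonneg _) (inv_le_one_of_one_le₀ hℓ1)
  -- With `N` the number of completed cycles, `T (k + 1) ≤ n` says `k < N`, and it depends only on
  -- the lengths of cycles `0, …, k`. So `ε n k` is predictable as a factor of `Y (k + 1)`. This is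
  -- why the approximating sum runs through the current cycle `N` instead of stopping at `N - 1`.
  set ε : ℕ → ℕ → Ω → ℝ := fun n k ω =>
    (if T ω (k + 1) ≤ n then 1 else 0) - (if k < m n then 1 else 0) with hε
  have hε1 : ∀ n k ω, |ε n k ω| ≤ 1 := fun n k ω => by
    simp only [hε]
    split_ifs <;> simp
  -- the filtration of the cycles
  set G : ℕ → MeasurableSpace Ω := fun j =>
    MeasurableSpace.comap (fun ω => (Y j ω, L j ω, W j ω)) inferInstance with hG
  set ℱ : ℕ → MeasurableSpace Ω := fun k => ⨆ j ∈ Set.Iic k, G j with hℱ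
  have hGle : ∀ j, G j ≤ mΩ := fun j =>
    ((hYm j).prodMk ((hLm j).prodMk (hWm j))).comap_le
  have hℱle : ∀ k, ℱ k ≤ mΩ := fun k => iSup₂_le fun j _ => hGle j
  have hGℱ : ∀ {j k : ℕ}, j ≤ k → G j ≤ ℱ k := fun {j k} hjk =>
    le_iSup₂ (f := fun j (_ : j ∈ Set.Iic k) => G j) j hjk
  have hℱmono : Monotone ℱ := fun k l hkl =>
    iSup₂_le fun j hj => hGℱ (le_trans hj hkl)
  have hCG : ∀ j, Measurable[G j] fun ω => (Y j ω, L j ω, W j ω) := fun j =>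
    comap_measurable _
  have hYG : ∀ j, Measurable[G j] (Y j) := fun j => measurable_fst.comp (hCG j)
  have hLG : ∀ j, Measurable[G j] (L j) := fun j =>
    measurable_fst.comp (measurable_snd.comp (hCG j))
  have hεℱ : ∀ n k, Measurable[ℱ k] (ε n k) := fun n k => by
    have hTk : Measurable[ℱ k] fun ω => T ω (k + 1) :=
      Finset.measurable_fun_sum _ fun i hi =>
        (hLG i).mono (hGℱ (Nat.lt_succ_iff.1 (Finset.mem_range.1 hi))) le_rfl
    have hg : Measurable fun t : ℕ => (if t ≤ n then (1 : ℝ) else 0) - (if k < m n then 1 else 0) :=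
      .of_discrete
    exact hg.comp hTk
  have hindℱ : ∀ k, Indep (ℱ k) (MeasurableSpace.comap (Y (k + 1)) inferInstance) μ := fun k => by
    have h1 : Indep (⨆ j ∈ Set.Iic k, G j) (⨆ j ∈ ({k + 1} : Set ℕ), G j) μ :=
      indep_iSup_of_disjoint hGle hind (by simp)
    rw [iSup_singleton] at h1
    exact indep_of_indep_of_le_right h1 (hYG (k + 1)).comap_le
  have hidY : ∀ k, IdentDistrib (Y (k + 1)) (Y 1) μ μ := fun k => (hident k).comp measurable_fst
  have hL2 := fun n => integral_sum_predictable_sq ℱ hℱmono hℱle (Y := fun k => Y (k + 1))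
    (ε := ε n) (v := v) (hεℱ n) (hε1 n)
    (fun k => (hYG (k + 1)).mono (hGℱ le_rfl) le_rfl) hindℱ
    (fun k => (hidY k).memLp_iff.2 hY2) (fun k => ((hidY k).integral_eq).trans hY0)
    (fun k => ((hidY k).comp (measurable_id.pow_const 2)).integral_eq) n
  have hεm : ∀ n k, Measurable (ε n k) := fun n k => (hεℱ n k).mono (hℱle k) le_rfl
  -- the random and the deterministic numbers of cycles are close
  have hεN : ∀ᵐ ω ∂μ, ∀ n k, ε n k ω
      = (if k < renewalCount (T ω) n then 1 else 0) - (if k < m n then 1 else 0) := by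
    filter_upwards [hTmono] with ω h1 n k
    simp only [hε, ← le_renewalCount_iff (hT0 ω) h1, Nat.succ_le_iff]
  -- The integrand is `|N - m| / n`, which is at most `1` and tends to `0` because both counts are
  -- asymptotic to `n / ℓ`.
  have hDlim : Tendsto (fun n : ℕ => ∫ ω, (∑ i ∈ Finset.range n, ε n i ω ^ 2) / n ∂μ) atTop
      (𝓝 0) := by
    rw [← integral_zero Ω ℝ (μ := μ)]
    refine tendsto_integral_of_dominated_convergence (fun _ => 1) (fun n => ?_)
      (integrable_const _) (fun n => .of_forall fun ω => ?_) ?_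
    · exact ((Finset.measurable_fun_sum _ fun i _ =>
        (hεm n i).pow_const 2).div_const _).aestronglyMeasurable
    · rw [Real.norm_of_nonneg (by positivity)]
      refine div_le_one_of_le₀ ?_ (Nat.cast_nonneg _)
      calc ∑ i ∈ Finset.range n, ε n i ω ^ 2 ≤ ∑ i ∈ Finset.range n, (1 : ℝ) :=
            Finset.sum_le_sum fun i _ => by
              rw [← sq_abs]; exact pow_le_one₀ (abs_nonneg _) (hε1 n i ω)
        _ = n := by simp
    · filter_upwards [hεN, hNlim] with ω h1 h2
      have h3 := (h2.sub hmlim).abs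
      rw [sub_self, abs_zero] at h3
      refine h3.congr fun n => ?_
      simp only [h1]
      rw [sum_sq_sub_indicator (renewalCount_le n) (hmle n), ← sub_div, abs_div, Nat.abs_cast]
  set Q : ℕ → Ω → ℝ := fun n ω => (∑ i ∈ Finset.range n, ε n i ω * Y (i + 1) ω) / √(n : ℝ) with hQ
  have hQ2 : ∀ n, MemLp (Q n) 2 μ := fun n => by
    have := (hL2 n).1.const_mul (√(n : ℝ))⁻¹
    refine this.congr_norm ?_ (.of_forall fun ω => ?_)
    · exact (((hL2 n).1.aestronglyMeasurable.aemeasurable).div_const _).aestronglyMeasurable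
    · simp only [hQ]; rw [div_eq_inv_mul]
  have hQlim : TendstoInMeasure μ Q atTop (fun _ => 0) := by
    refine tendstoInMeasure_of_tendsto_integral_sq hQ2 ?_
    have h1 := hDlim.const_mul v
    rw [mul_zero] at h1
    refine h1.congr fun n => ?_
    simp only [hQ, div_pow, Real.sq_sqrt (Nat.cast_nonneg _)]
    rw [integral_div, integral_div, (hL2 n).2, mul_div_assoc]
  set Z : ℕ → Ω → ℝ := fun n ω => (∑ i ∈ Finset.range (m n), Y (i + 1) ω) / √(n : ℝ) with hZ
  have hZm : ∀ n, Measurable (Z n) := fun n =>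
    (Finset.measurable_fun_sum _ fun i _ => hYm (i + 1)).div_const _
  have hQm : ∀ n, Measurable (Q n) := fun n =>
    (Finset.measurable_fun_sum _ fun i _ => (hεm n i).mul (hYm (i + 1))).div_const _
  have hZlim : TendstoInDistribution Z atTop (fun x : ℝ => √(v * ℓ⁻¹) * x) (fun _ => μ)
      (gaussianReal 0 1) := by
    have hindY : iIndepFun (fun i => Y (i + 1)) μ :=
      (hind.comp (fun _ p => p.1) (fun _ => measurable_fst)).precomp (add_left_injective 1)
    exact tendstoInDistribution_sum_div_sqrt hindY hidY hY2 hY0 hmtop hmlim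
  -- the boundary terms
  set R : ℕ → Ω → ℝ := fun n ω => X n ω / √(n : ℝ) - Z n ω - Q n ω with hR
  have hRm : ∀ n, Measurable (R n) := fun n =>
    (((hXm n).div_const _).sub (hZm n)).sub (hQm n)
  have hRlim : ∀ᵐ ω ∂μ, Tendsto (fun n => R n ω) atTop (𝓝 0) := by
    filter_upwards [hTmono, hεN, hNlim, hWlim, hX] with ω h1 h2 h3 h4 h5
    set N := renewalCount (T ω) with hN
    have hWN : Tendsto (fun n : ℕ => √(W (N n) ω ^ 2 / n)) atTop (𝓝 0) := by
      have h6 := (h4.comp (tendsto_renewalCount (hT0 ω) h1)).mul h3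
      rw [zero_mul] at h6
      have h7 := (Real.continuous_sqrt.tendsto 0).comp h6
      rw [Real.sqrt_zero] at h7
      refine h7.congr' ?_
      filter_upwards [(tendsto_renewalCount (hT0 ω) h1).eventually_gt_atTop 0] with n hn
      have hn' : (N n : ℝ) ≠ 0 := by exact_mod_cast hn.ne'
      simp only [Function.comp_apply]
      rw [div_mul_div_cancel₀ hn']
    have hY0' : Tendsto (fun n : ℕ => |Y 0 ω| / √(n : ℝ)) atTop (𝓝 0) :=
      tendsto_const_nhds.div_atTop (Real.tendsto_sqrt_atTop.comp tendsto_natCast_atTop_atTop)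
    have hbound := hWN.add hY0'
    rw [add_zero] at hbound
    refine squeeze_zero_norm (fun n => ?_) hbound
    -- The correction turns `m n` summands into `N n`. What is left of `X n` is the discrepancy
    -- within the current cycle, bounded by `W (N n)`, and the first cycle `Y 0`.
    have hsum : ∑ i ∈ Finset.range (m n), Y (i + 1) ω + ∑ i ∈ Finset.range n, ε n i ω * Y (i + 1) ω
        = ∑ i ∈ Finset.range (N n + 1), Y i ω - Y 0 ω := by
      have hind1 : ∀ k ≤ n, ∑ i ∈ Finset.range k, Y (i + 1) ω
          = ∑ i ∈ Finset.range n, (if i < k then 1 else 0) * Y (i + 1) ω := by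
        intro k hk
        simp only [ite_mul, one_mul, zero_mul]
        rw [← Finset.sum_filter]
        congr 1
        ext i
        simp
        omega
      rw [Finset.sum_range_succ', add_sub_cancel_right, hind1 _ (hmle n),
        hind1 _ (renewalCount_le n), ← Finset.sum_add_distrib]
      refine Finset.sum_congr rfl fun i _ => ?_
      rw [h2]
      ring
    have hRn : R n ω = (X n ω - ∑ i ∈ Finset.range (N n + 1), Y i ω + Y 0 ω) / √(n : ℝ) := by
      simp only [hR, hZ, hQ]
      rw [← sub_div, ← sub_div, sub_sub, hsum]
      congr 1
      ring
    have h6 := h5 n (N n) (apply_renewalCount_le (hT0 ω) n) (lt_apply_renewalCount_succ (hT0 ω) h1 n)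
    rw [hRn, Real.norm_eq_abs, abs_div, abs_of_nonneg (Real.sqrt_nonneg _),
      Real.sqrt_div (sq_nonneg _), Real.sqrt_sq_eq_abs, ← add_div]
    gcongr
    exact (abs_add_le _ _).trans (add_le_add (h6.trans (le_abs_self _)) le_rfl)
  have hRlim' : TendstoInMeasure μ R atTop (fun _ => 0) :=
    tendstoInMeasure_of_tendsto_ae (fun n => (hRm n).aestronglyMeasurable) hRlim
  have hfin := (hZlim.add_of_tendstoInMeasure_const hQlim
    (fun n => (hQm n).aemeasurable)).add_of_tendstoInMeasure_const hRlim'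
    (fun n => (hRm n).aemeasurable)
  refine hfin.congr (fun n => .of_forall fun ω => ?_) (.of_forall fun x => ?_)
  · simp only [Pi.add_apply, hR]
    ring
  · simp only [add_zero, div_eq_mul_inv]

end

/-! ### The central limit theorem for additive functionals -/

section

variable {S : Type*} [MeasurableSpace S]

variable [Countable S] [DiscreteMeasurableSpace S]
variable {P : Kernel S S} [IsMarkovKernel P]

lemma additiveFunctional_centered (f : S → ℝ) (π : Measure S) (n : ℕ) (ω : ℕ → S) :
    additiveFunctional (centered f π) n ω = additiveFunctional f n ω - n * ∫ x, f x ∂π := by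
  simp [additiveFunctional, centered, Finset.sum_sub_distrib]

lemma measurable_additiveFunctional (f : S → ℝ) (n : ℕ) : Measurable (additiveFunctional f n) :=
  Finset.measurable_fun_sum _ fun j _ => measurable_coord_comp f j

lemma enorm_centered_le (f : S → ℝ) (π : Measure S) (x : S) :
    ‖centered f π x‖ₑ ≤ (1 + ‖∫ y, f y ∂π‖ₑ) * (‖f x‖ₑ + 1) := by
  refine enorm_sub_le.trans ?_
  calc ‖f x‖ₑ + ‖∫ y, f y ∂π‖ₑ
      ≤ ‖f x‖ₑ + ‖∫ y, f y ∂π‖ₑ + (1 + ‖∫ y, f y ∂π‖ₑ * ‖f x‖ₑ) := le_self_add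
    _ = _ := by ring

omit [Countable S] [DiscreteMeasurableSpace S] in
lemma coe_returnLen_eq (z : S) (ω : ℕ → S) :
    (returnLen z ω : ℝ) = (returnTime z ω : ℝ≥0∞).toReal := by
  rw [returnLen]
  induction returnTime z ω with
  | top => simp
  | coe n => simp

section

variable (hfin : ∀ z x, occupation P z x Set.univ < ∞)
include hfin

lemma integrable_returnLen (z x : S) :
    Integrable (fun ω => (returnLen z ω : ℝ)) (lawFrom P x) := by
  simp only [coe_returnLen_eq]
  refine integrable_toReal_of_lintegral_ne_top ?_ ?_
  · rw [funext (toENNReal_returnTime z)]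
    exact (Measurable.tsum fun j =>
      measurable_const.indicator (measurableSet_notReturned z j)).aemeasurable
  · have := meanReturnTime_eq P z x
    rw [meanReturnTime] at this
    rw [this]
    exact (hfin z x).ne

lemma integral_returnLen (z x : S) :
    ∫ ω, (returnLen z ω : ℝ) ∂(lawFrom P x) = (meanReturnTime P x z).toReal := by
  simp only [coe_returnLen_eq]
  rw [integral_toReal]
  · rfl
  · rw [funext (toENNReal_returnTime z)]
    exact (Measurable.tsum fun j =>
      measurable_const.indicator (measurableSet_notReturned z j)).aemeasurable
  · filter_upwards [ae_returnTime_lt_top hfin z x] with ω hω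
    simpa using hω

/-- Central limit theorem for additive functionals whose cycle sums are centered and
square integrable. -/
lemma tendstoInDistribution_additiveFunctional {φ : S → ℝ} {z : S}
    (h2 : ∫⁻ y, ‖φ y‖ₑ * (∫⁻ y', ‖φ y'‖ₑ ∂(occupation P z y)) ∂(occupation P z z) < ∞)
    (h0 : ∫ ω, cycleSum φ z ω ∂(lawFrom P z) = 0) (ν : Measure S) [IsProbabilityMeasure ν] :
    TendstoInDistribution (fun (n : ℕ) ω => additiveFunctional φ n ω / √(n : ℝ)) atTop
      (fun x : ℝ => √((∫ ω, cycleSum φ z ω ^ 2 ∂(lawFrom P z)) / (meanReturnTime P z z).toReal) * x)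
      (fun _ => chainLaw P ν) (gaussianReal 0 1) := by
  have hτ := ae_returnTime_lt_top hfin z
  set θ := cycleShift (S := S) z with hθ
  have hθm : ∀ k, Measurable θ^[k] := fun k => (measurable_cycleShift z).iterate k
  set φ' : S → ℝ := fun x => |φ x| with hφ'
  -- Sum, length and absolute sum are treated as one cycle functional, so that independence and
  -- identity in law hold jointly.
  set C : (ℕ → S) → ℝ × ℕ × ℝ := fun ω => (cycleSum φ z ω, returnLen z ω, cycleSum φ' z ω) with hC
  have hCm : Measurable C := (measurable_cycleSum φ z).prodMk
    ((measurable_returnLen z).prodMk (measurable_cycleSum φ' z))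
  have hCc : IsCycleFunctional z C := fun n ω ω' h h' => by
    simp only [hC, isCycleFunctional_cycleSum φ z n ω ω' h h',
      isCycleFunctional_returnLen z n ω ω' h h', isCycleFunctional_cycleSum φ' z n ω ω' h h']
  have hid := identDistrib_cycles hτ hCm ν
  have hidY : IdentDistrib (fun ω => cycleSum φ z (θ^[1] ω)) (cycleSum φ z) (chainLaw P ν)
      (lawFrom P z) := (hid 0).comp (u := fun p : ℝ × ℕ × ℝ => p.1) measurable_fst
  have hidL : IdentDistrib (fun ω => (returnLen z (θ^[1] ω) : ℝ)) (fun ω => (returnLen z ω : ℝ))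
      (chainLaw P ν) (lawFrom P z) :=
    (hid 0).comp (u := fun p : ℝ × ℕ × ℝ => (p.2.1 : ℝ)) (by fun_prop)
  have hidW : IdentDistrib (fun ω => cycleSum φ' z (θ^[1] ω)) (cycleSum φ' z) (chainLaw P ν)
      (lawFrom P z) := (hid 0).comp (u := fun p : ℝ × ℕ × ℝ => p.2.2) (by fun_prop)
  have hY2 : MemLp (cycleSum φ z) 2 (lawFrom P z) :=
    (memLp_two_iff_integrable_sq (measurable_cycleSum φ z).aestronglyMeasurable).2
      (integrable_cycleSum_sq h2)
  have hW2 : Integrable (fun ω => cycleSum φ' z ω ^ 2) (lawFrom P z) :=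
    integrable_cycleSum_sq (by simpa [hφ'] using h2)
  have hlen : ∀ {ω : ℕ → S}, returnTime z ω < ⊤ → 1 ≤ returnLen z ω := fun {ω} h =>
    (mem_notReturned_iff_lt_returnLen h).1 (by rw [notReturned_zero]; trivial)
  have key := tendstoInDistribution_of_renewal (μ := chainLaw P ν)
    (Y := fun k ω => cycleSum φ z (θ^[k] ω)) (L := fun k ω => returnLen z (θ^[k] ω))
    (W := fun k ω => cycleSum φ' z (θ^[k] ω)) (X := additiveFunctional φ)
    (fun k => (measurable_cycleSum φ z).comp (hθm k))
    (fun k => (measurable_returnLen z).comp (hθm k))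
    (fun k => (measurable_cycleSum φ' z).comp (hθm k))
    (measurable_additiveFunctional φ) (iIndepFun_cycles hτ hCc hCm ν)
    (fun k => (hid k).trans (hid 0).symm)
    (by
      filter_upwards [ae_forall_returnTime_lt_top hτ ν] with ω hω k
      exact hlen (hω k))
    (hidL.integrable_iff.2 (integrable_returnLen hfin z z))
    (hidY.memLp_iff.2 hY2) (hidY.integral_eq.trans h0)
    ((hidW.comp (measurable_id.pow_const 2)).integrable_iff.2 hW2)
    (.of_forall fun ω n k hn hk => abs_additiveFunctional_sub_le φ z ω hn hk)
  have e1 : ∫ ω, cycleSum φ z (θ^[1] ω) ^ 2 ∂(chainLaw P ν)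
      = ∫ ω, cycleSum φ z ω ^ 2 ∂(lawFrom P z) :=
    (hidY.comp (measurable_id.pow_const 2)).integral_eq
  have e2 : ∫ ω, (returnLen z (θ^[1] ω) : ℝ) ∂(chainLaw P ν) = (meanReturnTime P z z).toReal :=
    hidL.integral_eq.trans (integral_returnLen hfin z z)
  rwa [e1, e2] at key

end

lemma sq_eq_sq_of_map_gaussianReal_eq {a b : ℝ}
    (h : (gaussianReal 0 1).map (fun x => a * x) = (gaussianReal 0 1).map (fun x => b * x)) :
    a ^ 2 = b ^ 2 := by
  rw [gaussianReal_map_const_mul, gaussianReal_map_const_mul] at h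
  have h2 := congrArg (fun μ : Measure ℝ => Var[id; μ]) h
  simpa [variance_id_gaussianReal] using h2

end

end MarkovCLT

end

/-! ### The main theorem -/

theorem theorem7 {S : Type*} [Countable S] [Nonempty S] [MeasurableSpace S]
    [DiscreteMeasurableSpace S]
    (P : Kernel S S) [IsMarkovKernel P]
    -- irreducibility: for all `x`, `y` there is `n` with `P^n(x, y) > 0`
    (hirr : Kernel.IsIrreducible Measure.count P)
    (f : S → ℝ) (K : Finset S) (v₁ v₂ : S → ℝ≥0)
    (hK₁ : ∀ x ∈ K, ∫⁻ y, (v₁ y : ℝ≥0∞) ∂(P x) < ∞)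
    (hK₂ : ∀ x ∈ K, ∫⁻ y, (v₂ y : ℝ≥0∞) ∂(P x) < ∞)
    -- the drift inequalities, with the negative term moved to the left-hand side
    (hv₁ : ∀ x ∉ K, (∫⁻ y, (v₁ y : ℝ≥0∞) ∂(P x)) + (‖f x‖ₑ + 1) ≤ v₁ x)
    (hv₂ : ∀ x ∉ K, (∫⁻ y, (v₂ y : ℝ≥0∞) ∂(P x)) + (‖f x‖ₑ + 1) * v₁ x ≤ v₂ x) :
    MarkovCLT.PositiveRecurrent P ∧
    ∃ π : Measure S,
      (MarkovCLT.IsStationaryDistribution P π ∧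
        ∀ π' : Measure S, MarkovCLT.IsStationaryDistribution P π' → π' = π) ∧
      Integrable f π ∧
      (∀ z : S, ∫⁻ ω, MarkovCLT.absCycleSum (MarkovCLT.centered f π) z ω ^ 2
        ∂(MarkovCLT.lawFrom P z) < ∞) ∧
      -- the quantities in the formulas for `σ ^ 2` below are well defined
      (∀ x z : S, (∀ᵐ ω ∂(MarkovCLT.lawFrom P x), MarkovCLT.returnTime z ω < ⊤) ∧
        Integrable (MarkovCLT.cycleSum (MarkovCLT.centered f π) z) (MarkovCLT.lawFrom P x)) ∧
      (∀ z : S, Integrable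
        (fun x => MarkovCLT.poissonSol P f π z x * MarkovCLT.centered f π x) π) ∧
      Integrable (fun x => MarkovCLT.centered f π x ^ 2) π ∧
      ∃ σ : ℝ, 0 ≤ σ ∧
        (∀ z : S, σ ^ 2 =
          (∫ ω, MarkovCLT.cycleSum (MarkovCLT.centered f π) z ω ^ 2 ∂(MarkovCLT.lawFrom P z)) /
            (MarkovCLT.meanReturnTime P z z).toReal) ∧
        (∀ z : S, σ ^ 2 =
          2 * ∫ x, MarkovCLT.poissonSol P f π z x * MarkovCLT.centered f π x ∂π
            - ∫ x, MarkovCLT.centered f π x ^ 2 ∂π) ∧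
        ∀ (ν : Measure S) [IsProbabilityMeasure ν],
          TendstoInDistribution
            (fun (n : ℕ) (ω : ℕ → S) =>
              (MarkovCLT.additiveFunctional f n ω - n * ∫ x, f x ∂π) / √(n : ℝ))
            atTop (fun x : ℝ => σ * x) (fun _ => MarkovCLT.chainLaw P ν) (gaussianReal 0 1) := by
  have hH : ∀ x, ‖f x‖ₑ + 1 < ∞ := fun x => ENNReal.add_lt_top.2 ⟨enorm_lt_top, ENNReal.one_lt_top⟩
  have hmom := MarkovCLT.occupation_moments_lt_top P hirr K hH hK₁ hK₂ hv₁ hv₂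
  have hfin : ∀ z x, MarkovCLT.occupation P z x Set.univ < ∞ := fun z x => by
    refine lt_of_le_of_lt ?_ (hmom z x).1
    rw [← lintegral_one]
    exact lintegral_mono fun y => le_add_self
  have hpos : ∀ z x, MarkovCLT.occupation P z x Set.univ ≠ 0 := fun z x =>
    (zero_lt_one.trans_le (MarkovCLT.one_le_occupation_univ P z x)).ne'
  obtain ⟨z₀⟩ := ‹Nonempty S›
  refine ⟨fun z => by rw [MarkovCLT.meanReturnTime_eq]; exact hfin z z, ?_⟩
  obtain ⟨π, hπ⟩ : ∃ π, π = (MarkovCLT.occupation P z₀ z₀ Set.univ)⁻¹ •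
    MarkovCLT.occupation P z₀ z₀ := ⟨_, rfl⟩
  have hstat : MarkovCLT.IsStationaryDistribution P π :=
    hπ ▸ MarkovCLT.isStationaryDistribution_occupation hfin z₀
  have hπz := MarkovCLT.eq_occupation_of_stationary hfin hstat
  have hlint : ∀ {g : S → ℝ≥0∞} (z : S), ∫⁻ y, g y ∂(MarkovCLT.occupation P z z) < ∞ →
      ∫⁻ y, g y ∂π < ∞ := fun {g} z h => by
    rw [hπz z, lintegral_smul_measure]
    exact ENNReal.mul_lt_top (ENNReal.inv_lt_top.2 (pos_iff_ne_zero.2 (hpos z z))) h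
  have hint : ∀ (g : S → ℝ) (z : S), ∫ y, g y ∂(MarkovCLT.occupation P z z)
      = (MarkovCLT.meanReturnTime P z z).toReal * ∫ y, g y ∂π := fun g z => by
    have h0 : (MarkovCLT.occupation P z z Set.univ).toReal ≠ 0 :=
      (ENNReal.toReal_pos (hpos z z) (hfin z z).ne).ne'
    rw [hπz z, integral_smul_measure, MarkovCLT.meanReturnTime_eq, ENNReal.toReal_inv, smul_eq_mul,
      mul_inv_cancel_left₀ h0]
  have := hstat.1
  have hfπ : Integrable f π := by
    refine ⟨(Measurable.of_discrete (f := f)).aestronglyMeasurable, hlint z₀ ?_⟩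
    exact (lintegral_mono fun y => le_self_add).trans_lt (hmom z₀ z₀).1
  obtain ⟨φ, hφ⟩ : ∃ φ, φ = MarkovCLT.centered f π := ⟨_, rfl⟩
  have hφ0 : ∫ y, φ y ∂π = 0 := by
    rw [hφ]
    simp only [MarkovCLT.centered]
    rw [integral_sub hfπ (integrable_const _)]
    simp
  -- `|f_c| ≤ c (|f| + 1)`, so the moment bounds for `|f| + 1` pass to `f_c` with factors `c` and
  -- `c²`.
  obtain ⟨c, hc⟩ : ∃ c, c = 1 + ‖∫ y, f y ∂π‖ₑ := ⟨_, rfl⟩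
  have hclt : c < ∞ := hc ▸ ENNReal.add_lt_top.2 ⟨ENNReal.one_lt_top, enorm_lt_top⟩
  have hφle : ∀ x, ‖φ x‖ₑ ≤ c * (‖f x‖ₑ + 1) := fun x => by
    rw [hφ, hc]; exact MarkovCLT.enorm_centered_le f π x
  have hU : ∀ z x, ∫⁻ y, ‖φ y‖ₑ ∂(MarkovCLT.occupation P z x)
      ≤ c * ∫⁻ y, (‖f y‖ₑ + 1) ∂(MarkovCLT.occupation P z x) := fun z x => by
    rw [← lintegral_const_mul _ .of_discrete]
    exact lintegral_mono hφle
  have h1 : ∀ z x, ∫⁻ y, ‖φ y‖ₑ ∂(MarkovCLT.occupation P z x) < ∞ := fun z x =>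
    (hU z x).trans_lt (ENNReal.mul_lt_top hclt (hmom z x).1)
  have h2 : ∀ z x, ∫⁻ y, ‖φ y‖ₑ * (∫⁻ y', ‖φ y'‖ₑ ∂(MarkovCLT.occupation P z y))
      ∂(MarkovCLT.occupation P z x) < ∞ := fun z x => by
    refine (lintegral_mono fun y => mul_le_mul' (hφle y) (hU z y)).trans_lt ?_
    simp only [mul_mul_mul_comm c]
    rw [lintegral_const_mul _ .of_discrete]
    exact ENNReal.mul_lt_top (ENNReal.mul_lt_top hclt hclt) (hmom z x).2
  have hgφ : ∀ z, Integrable (fun x => MarkovCLT.poissonSol P f π z x * φ x) π := fun z => by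
    refine ⟨Measurable.of_discrete.aestronglyMeasurable, hlint z ?_⟩
    refine lt_of_le_of_lt (lintegral_mono fun x => ?_) (h2 z z)
    rw [enorm_mul, mul_comm]
    gcongr
    rw [MarkovCLT.poissonSol, ← hφ]
    exact MarkovCLT.enorm_integral_cycleSum_le φ z x
  have hφ2 : Integrable (fun x => φ x ^ 2) π := by
    refine ⟨Measurable.of_discrete.aestronglyMeasurable, hlint z₀ ?_⟩
    refine lt_of_le_of_lt (lintegral_mono fun x => ?_) (h2 z₀ z₀)
    rw [enorm_pow, sq]
    gcongr
    exact MarkovCLT.enorm_le_lintegral_occupation φ z₀ x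
  have hmean : ∀ z, ∫ ω, MarkovCLT.cycleSum φ z ω ∂(MarkovCLT.lawFrom P z) = 0 := fun z => by
    rw [MarkovCLT.integral_cycleSum hfin (h1 z z), hint, hφ0, mul_zero]
  have hvar : ∀ z, (∫ ω, MarkovCLT.cycleSum φ z ω ^ 2 ∂(MarkovCLT.lawFrom P z)) /
      (MarkovCLT.meanReturnTime P z z).toReal
      = 2 * ∫ x, MarkovCLT.poissonSol P f π z x * φ x ∂π - ∫ x, φ x ^ 2 ∂π := fun z => by
    have hm0 : (MarkovCLT.meanReturnTime P z z).toReal ≠ 0 := by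
      rw [MarkovCLT.meanReturnTime_eq]
      exact (ENNReal.toReal_pos (hpos z z) (hfin z z).ne).ne'
    rw [MarkovCLT.integral_cycleSum_sq hfin (h1 z) (h2 z z), hint, mul_div_cancel_left₀ _ hm0,
      ← integral_const_mul, ← integral_sub ((hgφ z).const_mul 2) hφ2]
    refine integral_congr_ae (.of_forall fun x => ?_)
    simp only [MarkovCLT.poissonSol, ← hφ]
    ring
  have hCLT := fun z (ν : Measure S) [IsProbabilityMeasure ν] =>
    MarkovCLT.tendstoInDistribution_additiveFunctional hfin (h2 z z) (hmean z) ν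
  obtain ⟨s, hs⟩ : ∃ s : S → ℝ, s = fun z =>
    (∫ ω, MarkovCLT.cycleSum φ z ω ^ 2 ∂(MarkovCLT.lawFrom P z)) /
      (MarkovCLT.meanReturnTime P z z).toReal := ⟨_, rfl⟩
  have hs0 : ∀ z, 0 ≤ s z := fun z => by
    rw [hs]
    exact div_nonneg (integral_nonneg fun ω => sq_nonneg _) ENNReal.toReal_nonneg
  -- The same normalized sums, under the same initial law, converge for every choice of regeneration
  -- state. The Gaussian limits therefore coincide, and so do their variances.
  have hsz : ∀ z, √(s z₀) ^ 2 = s z := fun z => by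
    rw [← Real.sq_sqrt (hs0 z)]
    refine MarkovCLT.sq_eq_sq_of_map_gaussianReal_eq ?_
    rw [hs]
    exact tendstoInDistribution_unique _ (hCLT z₀ (Measure.dirac z₀)) (hCLT z (Measure.dirac z₀))
  refine ⟨π, ⟨hstat, fun π' hπ' => ?_⟩, hfπ, ?_⟩
  · rw [MarkovCLT.eq_occupation_of_stationary hfin hπ' z₀, ← hπz z₀]
  rw [← hφ]
  refine ⟨fun z => MarkovCLT.lintegral_absCycleSum_sq_lt_top (h2 z z), fun x z =>
    ⟨MarkovCLT.ae_returnTime_lt_top hfin z x, MarkovCLT.integrable_cycleSum (h1 z x)⟩, hgφ, hφ2,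
    √(s z₀), Real.sqrt_nonneg _, fun z => ?_, fun z => ?_, fun ν _ => ?_⟩
  · rw [hsz z, hs]
  · rw [hsz z, hs]
    exact hvar z
  · have h := hCLT z₀ ν
    rw [hφ] at h
    simp only [MarkovCLT.additiveFunctional_centered] at h
    rw [hs, hφ]
    exact h
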